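/- **Setting.** Let $m\ge 2$. All graphs are finite, simple and undirected, with $m$ distinct marked vertices $v_1,\dots,v_m$ and a variable $a_e$ for each edge $e$. For a set partition $P$ of $\{1,\dots,m\}$, write $F\sim P$ if $F$ is (the edge set of) a spanning forest for which there is a bijection between its trees (isolated vertices included) and the parts of $P$ such that each marked vertex lies in the tree corresponding to its part. The spanning forest polynomial of $P$ on $G$ is $\sum_{F\sim P}\prod_{e\notin F}a_e$. We write $(1,\dots,1)$ for the partition with one part, $(1,2,\dots,m)$ for the partition into singletons, and use the same symbols for their polynomials. An $A$ is a set partition into $m-1$ parts and a $B$ is a set partition into $2$ parts; let $V_m$ be the free $\mathbb Z$-module on the formal monomials $AB$ (ordered pairs). A monomial $AB$ is *forbidden* if two distinct marked vertices lie in the same part both in $A$ and in $B$. For $c,j\in\{1,\dots,m\}$ it is *permissible with respect to $(c,j)$* if in $A$ the vertex $j$ is paired with some $\ell\ne j$ and all other vertices are singletons, and in $B$ the vertex $j$ is in one part and $c,\ell$ are in the other. Let $J\in V_m$ be the sum of all non-forbidden monomials $AB$, each taken once. **The identities.** Let $L$ be the weighted Laplacian of $G$, with the marked vertices listed first and in order,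 let $L_{U,W}$ be $L$ with the rows $U$ and the columns $W$ removed, and for $r,c\in\{1,\dots,m\}$, $1\le j\le m-1$, consider the column expansion identity $$\det M\,\det M_{[k],[k]}=\sum_{i=1}^{k}(-1)^{i+j}\det M_{i,j}\,\det M_{[k]\setminus\{i\},[k]\setminus\{j\}},\qquad k=m-1,\ M=L_{r,c}.$$ Let $\hat\imath$ be the $i$-th element of $[m]\setminus\{r\}$ and $\hat\jmath$ the $j$-th element of $[m]\setminus\{c\}$. For $U,W\subseteq[m]$ of equal size and a set partition $P$ of $[m]$, let $\varepsilon_{U,W}(P)=0$ unless each part of $P$ contains exactly one element of $U$ and exactly one element of $W$, and otherwise $\varepsilon_{U,W}(P)=(-1)^{\sum U+\sum W+\mathrm{inv}}$, where $\mathrm{inv}$ is the number of inversions of the bijection $U\to W$ defined by the parts of $P$. Define $$L_{r,c}(j)=(-1)^{r+c}\sum_{i=1}^{m-1}(-1)^{i+j}\sum_{A,B}\varepsilon_{[m]\setminus\{\hat\imath\},[m]\setminus\{\hat\jmath\}}(A)\;\varepsilon_{\{\hat\imath,r\},\{\hat\jmath,c\}}(B)\;AB\ \in V_m .$$ The *block*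 of $c$ (with removed row $r$) is the set of the $m-1$ identities $(1,\dots,1)(1,2,\dots,m)=L_{r,c}(j)$, $1\le j\le m-1$. **Theorem.** Let $m\ge2$. 1. For all $r,c\in\{1,\dots,m\}$, $\sum_{j=1}^{m-1}L_{r,c}(j)=J$ in $V_m$. In particular all blocks have the same right-hand side $J$. 2. For every $c$, a monomial $AB$ is non-forbidden if and only if it is permissible with respect to $(c,j)$ for some $j$. Thus $J$ consists of exactly one copy of each permissible monomial. 3. Let $G$ be any graph with $m$ marked vertices. For all $r,c,j$: - the column expansion identity $j$ for $M=L_{r,c}$ holds, and its determinants have the following expansions, in which $(P)^{*}=\sum_{F\sim P}\prod_{e\in F}a_e$: $\det M=(-1)^{r+c}(1,\dots,1)^{*}$, $\det M_{[k],[k]}=(1,2,\dots,m)^{*}$, and for each $i$, $\det M_{[k]\setminus\{i\},[k]\setminus\{j\}}=\sum_A\varepsilon_{[m]\setminus\{\hat\imath\},[m]\setminus\{\hat\jmath\}}(A)\,(A)^{*}$ and $\det M_{i,j}=\sum_B\varepsilon_{\{\hat\imath,r\},\{\hat\jmath,c\}}(B)\,(B)^{*}$; - the identity $(1,\dots,1)(1,2,\dots,m)=L_{r,c}(j)$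 holds for the spanning forest polynomials of $G$. Consequently, summing a block, the identity $(m-1)\cdot(1,\dots,1)(1,2,\dots,m)=J$, with $m-1$ copies on the left and exactly one copy of each non-forbidden monomial $AB$ on the right, holds for the spanning forest polynomials of $G$. -/

import Mathlib

universe u

namespace ForestId

/-! ### Set partitions of the marked vertices

The marked vertices are indexed by `Fin m`; a set partition of them is a `Setoid (Fin m)`, with
`P a b` meaning that `a` and `b` lie in the same part.  The partition `(1,1,…,1)` is `⊤` and the
partition `(1,2,…,m)` is `⊥`. -/

instance finiteSetoid (m : ℕ) : Finite (Setoid (Fin m)) :=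
  Finite.of_injective (fun P : Setoid (Fin m) => fun a b : Fin m => P a b)
    (fun P Q h => Setoid.ext fun a b => by
      have := congrFun (congrFun h a) b
      exact iff_of_eq this)

/-- The number of parts of a set partition. -/
noncomputable def numParts {m : ℕ} (P : Setoid (Fin m)) : ℕ := Nat.card (Quotient P)

/-- The `A` partitions: set partitions of the `m` marked vertices into `m - 1` parts. -/
abbrev APart (m : ℕ) : Type := {P : Setoid (Fin m) // numParts P = m - 1}

/-- The `B` partitions: set partitions of the `m` marked vertices into two parts. -/
abbrev BPart (m : ℕ) : Type := {P : Setoid (Fin m) // numParts P = 2}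

noncomputable instance fintypeAPart (m : ℕ) : Fintype (APart m) := Fintype.ofFinite _

noncomputable instance fintypeBPart (m : ℕ) : Fintype (BPart m) := Fintype.ofFinite _

/-- The free module on the formal monomials `A B` (ordered pairs of an `A` and a `B` partition). -/
abbrev VSpace (m : ℕ) : Type := (APart m × BPart m) →₀ ℤ

/-- The formal monomial `A B`. -/
noncomputable def monom {m : ℕ} (A : APart m) (B : BPart m) : VSpace m := Finsupp.single (A, B) 1

/-- A pair of partitions is forbidden if two distinct marked vertices are in the same part in
both. -/
def Forbidden {m : ℕ} (P Q : Setoid (Fin m)) : Prop := ∃ a b, a ≠ b ∧ P a b ∧ Q a b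

/-- The pair `A B` is permissible with respect to the column `c` and the vertex `j`: in `A`, `j`
is paired with some `l` and all other vertices are singletons; in `B`, `j` is in one part and `c`
and `l` are in the other part. -/
def Permissible {m : ℕ} (c j : Fin m) (A : APart m) (B : BPart m) : Prop :=
  ∃ l, l ≠ j ∧ A.1 j l ∧ (∀ x y, x ≠ y → A.1 x y → s(x, y) = s(j, l)) ∧ ¬ B.1 j c ∧ B.1 c l

open Classical in
/-- `J`: the sum of one copy of each non-forbidden monomial `A B`. -/
noncomputable def sumNonForbidden (m : ℕ) : VSpace m :=
  ∑ A : APart m, ∑ B : BPart m, if Forbidden A.1 B.1 then 0 else monom A B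

/-! ### The formal right-hand side of the identity for the removed row `r` and column `c`, and
the expansion column `j` -/

/-- Every part of `P` contains exactly one element of `U` and exactly one element of `W`. -/
def Matches {m : ℕ} (U W : Finset (Fin m)) (P : Setoid (Fin m)) : Prop :=
  ∀ a, (∃! u, u ∈ U ∧ P u a) ∧ (∃! w, w ∈ W ∧ P w a)

open Classical in
/-- The number of inversions of the matching between `U` and `W` given by the parts of `P`. -/
noncomputable def inversions {m : ℕ} (U W : Finset (Fin m)) (P : Setoid (Fin m)) : ℕ :=
  (((U ×ˢ U) ×ˢ (W ×ˢ W)).filter fun q =>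
    q.1.1 < q.1.2 ∧ P q.1.1 q.2.1 ∧ P q.1.2 q.2.2 ∧ q.2.2 < q.2.1).card

open Classical in
/-- The signed coefficient with which the all minors matrix tree theorem writes the partition `P`
in the expansion of the Laplacian minor with the marked rows `U` and the marked columns `W`
removed. (Numbering the vertices from `0` does not change the sign, as `U` and `W` have the same
size.) -/
noncomputable def minorCoeff {m : ℕ} (U W : Finset (Fin m)) (P : Setoid (Fin m)) : ℤ :=
  if Matches U W P then (-1) ^ (∑ x ∈ U, (x : ℕ) + ∑ y ∈ W, (y : ℕ) + inversions U W P) else 0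

/-- The formal sum `L_{r,c}(j)` of pairs `A B`, for `m = d + 2` marked vertices.  Here `i` and `j`
index the marked rows and columns that are left after the removal of `r` and `c`; they correspond
to the marked vertices `r.succAbove i` and `c.succAbove j`.  The `B` partitions come from the
minor with rows `i, r` and columns `j, c` removed, the `A` partitions from the minor with all
marked rows but `i` and all marked columns but `j` removed, and the sign `(-1) ^ (r + c)` is that
of `det L_{r,c} = ± (1,…,1)` on the left-hand side. -/
noncomputable def rhs {d : ℕ} (r c : Fin (d + 2)) (j : Fin (d + 1)) : VSpace (d + 2) :=
  (-1 : ℤ) ^ ((r : ℕ) + c) • ∑ i : Fin (d + 1), (-1 : ℤ) ^ ((i : ℕ) + j) •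
    ∑ A : APart (d + 2), ∑ B : BPart (d + 2),
      (minorCoeff {r.succAbove i}ᶜ {c.succAbove j}ᶜ A.1 *
        minorCoeff {r.succAbove i, r} {c.succAbove j, c} B.1) • monom A B

/-! ### Spanning forest polynomials -/

/-- `F` is the edge set of a spanning forest of `G` for which there is a bijection between the
parts of `P` and the trees of the forest (isolated vertices count as trees), such that every
marked vertex lies in the tree that corresponds to its part. -/
def IsForestFor {V : Type u} {m : ℕ} (G : SimpleGraph V) (v : Fin m ↪ V) (P : Setoid (Fin m))
    (F : Finset (Sym2 V)) : Prop :=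
  (F : Set (Sym2 V)) ⊆ G.edgeSet ∧
  (SimpleGraph.fromEdgeSet (F : Set (Sym2 V))).IsAcyclic ∧
  ∃ φ : Quotient P ≃ (SimpleGraph.fromEdgeSet (F : Set (Sym2 V))).ConnectedComponent,
    ∀ a, φ (Quotient.mk P a) =
      (SimpleGraph.fromEdgeSet (F : Set (Sym2 V))).connectedComponentMk (v a)

open Classical in
/-- The spanning forest polynomial `∑_F ∏_{e ∉ F} a_e` of `G` and `P`. -/
noncomputable def forestPoly {V : Type u} [Fintype V] {m : ℕ} (G : SimpleGraph V) (v : Fin m ↪ V)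
    (P : Setoid (Fin m)) : MvPolynomial (Sym2 V) ℤ :=
  ∑ F : Finset (Sym2 V) with IsForestFor G v P F,
    ∏ e : Sym2 V with e ∈ G.edgeSet ∧ e ∉ F, MvPolynomial.X e

open Classical in
/-- The generating polynomial `∑_F ∏_{e ∈ F} a_e` of the same spanning forests. -/
noncomputable def forestGen {V : Type u} [Fintype V] {m : ℕ} (G : SimpleGraph V) (v : Fin m ↪ V)
    (P : Setoid (Fin m)) : MvPolynomial (Sym2 V) ℤ :=
  ∑ F : Finset (Sym2 V) with IsForestFor G v P F, ∏ e ∈ F, MvPolynomial.X e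

/-- Evaluation of a formal sum of pairs `A B` on a graph with marked vertices, each set partition
being replaced by its spanning forest polynomial. -/
noncomputable def evalAB {V : Type u} [Fintype V] {m : ℕ} (G : SimpleGraph V) (v : Fin m ↪ V) :
    VSpace m →ₗ[ℤ] MvPolynomial (Sym2 V) ℤ :=
  Finsupp.linearCombination ℤ fun p => forestPoly G v p.1.1 * forestPoly G v p.2.1

/-! ### Laplacian minors and the column expansion identities -/

open Classical in
/-- The weight of the edge from `x` to `y`: its variable, or `0` for a non-edge. -/
noncomputable def wt {V : Type u} (G : SimpleGraph V) (x y : V) : MvPolynomial (Sym2 V) ℤ :=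
  if G.Adj x y then MvPolynomial.X s(x, y) else 0

open Classical in
/-- The weighted Laplacian of `G`. -/
noncomputable def lap {V : Type u} [Fintype V] (G : SimpleGraph V) :
    Matrix V V (MvPolynomial (Sym2 V) ℤ) :=
  Matrix.of fun x y => if x = y then ∑ z ∈ Finset.univ.erase x, wt G x z else - wt G x y

/-- The unmarked vertices. -/
abbrev Unmarked {V : Type u} {m : ℕ} (v : Fin m ↪ V) : Type u := {x : V // x ∉ Set.range v}

open Classical in
noncomputable instance fintypeUnmarked {V : Type u} [Fintype V] {m : ℕ} (v : Fin m ↪ V) :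
    Fintype (Unmarked v) := Fintype.ofFinite _

/-- The matrix `L_{r,c}`: the Laplacian, with the marked vertices listed first and in order, with
the row of the marked vertex `r` and the column of the marked vertex `c` removed. -/
noncomputable def lapRemove {V : Type u} [Fintype V] {k : ℕ} (G : SimpleGraph V)
    (v : Fin (k + 1) ↪ V) (r c : Fin (k + 1)) :
    Matrix (Fin k ⊕ Unmarked v) (Fin k ⊕ Unmarked v) (MvPolynomial (Sym2 V) ℤ) :=
  (lap G).submatrix (Sum.elim (fun i => v (r.succAbove i)) Subtype.val)
    (Sum.elim (fun j => v (c.succAbove j)) Subtype.val)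

open Classical in
/-- `det M_{i,j}`, with the distinguished row `i` and column `j` removed. -/
noncomputable def detDrop {R : Type*} [CommRing R] {k : ℕ} {W : Type*} [Fintype W]
    (M : Matrix (Fin (k + 1) ⊕ W) (Fin (k + 1) ⊕ W) R) (i j : Fin (k + 1)) : R :=
  (M.submatrix (Sum.map i.succAbove id) (Sum.map j.succAbove id)).det

open Classical in
/-- `det M_{[k]∖{i},[k]∖{j}}`, with all distinguished rows but `i` and columns but `j` removed. -/
noncomputable def detKeep {R : Type*} [CommRing R] {k : ℕ} {W : Type*} [Fintype W]
    (M : Matrix (Fin k ⊕ W) (Fin k ⊕ W) R) (i j : Fin k) : R :=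
  (M.submatrix (Sum.map (fun _ : Unit => i) id) (Sum.map (fun _ : Unit => j) id)).det

open Classical in
/-- `det M_{[k],[k]}`, with all distinguished rows and columns removed. -/
noncomputable def detCore {R : Type*} [CommRing R] {k : ℕ} {W : Type*} [Fintype W]
    (M : Matrix (Fin k ⊕ W) (Fin k ⊕ W) R) : R :=
  (M.submatrix Sum.inr Sum.inr).det

open Classical in
/-- The column expansion identity `j` for the matrix `M = L_{r,c}` holds, and its determinants
have the spanning forest expansions from which the formal sum `rhs r c j` is assembled. -/
structure ArisesFromColumnExpansion {V : Type u} [Fintype V] {d : ℕ} (G : SimpleGraph V)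
    (v : Fin (d + 2) ↪ V) (r c : Fin (d + 2)) (j : Fin (d + 1)) : Prop where
  expansion : (lapRemove G v r c).det * detCore (lapRemove G v r c) =
    ∑ i : Fin (d + 1), (-1) ^ ((i : ℕ) + j) *
      (detDrop (lapRemove G v r c) i j * detKeep (lapRemove G v r c) i j)
  tree : (lapRemove G v r c).det = (-1) ^ ((r : ℕ) + c) * forestGen G v ⊤
  core : detCore (lapRemove G v r c) = forestGen G v ⊥
  keep : ∀ i, detKeep (lapRemove G v r c) i j =
    ∑ A : APart (d + 2), minorCoeff {r.succAbove i}ᶜ {c.succAbove j}ᶜ A.1 • forestGen G v A.1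
  drop : ∀ i, detDrop (lapRemove G v r c) i j =
    ∑ B : BPart (d + 2),
      minorCoeff {r.succAbove i, r} {c.succAbove j, c} B.1 • forestGen G v B.1

end ForestId

/-! Part 3 rests on two facts. For a block matrix with invertible unmarked block `D`, every minor
keeping that block is `det D` times the corresponding minor of the Schur complement, so the identity
is the Laplace expansion of the Schur complement along column `j`. A generic perturbation of `D`
removes the invertibility (`column_expansion`).

The determinants are expanded by an all minors matrix tree theorem (`det_lap_submatrix`). The
Laplacian is a sum over edges of weighted rank-one matrices, so Cauchy-Binet gives a sum over edge
sets `F` of products of two incidence minors. Such a product is nonzero exactly when `F` is a forest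
in which each tree has one removed row vertex and one removed column vertex. Its sign is found
without orienting anything: incidence rows sum to zero over a tree, so one row set is an explicit
integer matrix times the other, the determinant of the first minor appears squared, and a small
determinant indexed by marked vertices remains. That determinant is then matched with `minorCoeff`.

Part 1 is a factorisation. If `A` pairs `a` with `b`, its coefficient is `δ x * δ y` with `δ` the
difference of the indicators of `a` and `b`; the coefficient of `B` is, up to position signs that
cancel, also a function of `x` times a function of `y`. The double sum is therefore a product of two
differences, zero if `B` joins `a` and `b` and one otherwise (`sum_minorCoeff_mul_pairSign`).

Finally, inverting all variables and multiplying by the product of the edge variables turns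
`forestGen` into `forestPoly`. Every monomial has two factors, so the identity is preserved. -/

namespace ForestId

/-! ### Determinants: Cauchy-Binet, cofactors and the column expansion identity -/

section LinearAlgebra

open Matrix Finset

/-- The **Cauchy-Binet formula**, for any choice of enumerations of the column sets. -/
theorem det_mul_eq_sum_powersetCard {n E R : Type*} [Fintype n] [DecidableEq n] [Fintype E]
    [DecidableEq E] [CommRing R] (A : Matrix n E R) (B : Matrix E n R) (f : Finset E → n → E)
    (hf : ∀ S, S.card = Fintype.card n → Function.Injective (f S) ∧ univ.image (f S) = S) :
    (A * B).det = ∑ S ∈ powersetCard (Fintype.card n) univ,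
      (A.submatrix id (f S)).det * (B.submatrix (f S) id).det := by
  have h1 : (A * B).det = ∑ g : n → E, (∏ i, A i (g i)) * (B.submatrix g id).det := by
    have : A * B = fun i => ∑ e, A i e • B e := by
      ext i j
      simp [Matrix.mul_apply]
    rw [this]
    have h := (detRowAlternating (n := n) (R := R)).toMultilinearMap.map_sum
      (fun i e => A i e • B e)
    refine h.trans (sum_congr rfl fun g _ => ?_)
    exact (detRowAlternating (n := n) (R := R)).toMultilinearMap.map_smul_univ
      (fun i => A i (g i)) (fun i => B (g i))
  -- Non-injective `g` repeat a row of `B` and vanish. The injective ones are grouped by their image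
  -- `S`; those with image `S` are `f S ∘ σ` for a unique permutation `σ`.
  rw [h1, ← sum_filter_of_ne (p := fun g : n → E => Function.Injective g)]
  · rw [← sum_fiberwise_of_maps_to (g := fun g : n → E => univ.image g)
      (t := powersetCard (Fintype.card n) univ)]
    · refine sum_congr rfl fun S hS => ?_
      obtain ⟨hinj, himg⟩ := hf S (mem_powersetCard.1 hS).2
      rw [← det_transpose (A.submatrix id (f S)), det_apply, sum_mul]
      symm
      refine sum_bij (fun σ _ => f S ∘ σ) ?_ ?_ ?_ ?_
      · intro σ _
        simp only [mem_filter, mem_univ, true_and]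
        refine ⟨hinj.comp σ.injective, ?_⟩
        refine Eq.trans ?_ himg
        ext e
        simp only [mem_image, mem_univ, true_and, Function.comp]
        exact ⟨fun ⟨a, h⟩ => ⟨σ a, h⟩, fun ⟨a, h⟩ => ⟨σ.symm a, by simpa using h⟩⟩
      · intro σ _ τ _ h
        ext i
        exact hinj (congrFun h i)
      · intro g hg
        simp only [mem_filter, mem_univ, true_and] at hg
        have : ∀ i, ∃ j, f S j = g i := by
          intro i
          have : g i ∈ univ.image (f S) := by
            rw [himg, ← hg.2]; exact mem_image_of_mem _ (mem_univ _)
          simpa using this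
        choose τ hτ using this
        have hτi : Function.Injective τ := fun a b h => hg.1 (by rw [← hτ, ← hτ, h])
        exact ⟨Equiv.ofBijective τ (Finite.injective_iff_bijective.1 hτi), mem_univ _,
          funext hτ⟩
      · intro σ _
        have : B.submatrix (f S ∘ σ) id = (B.submatrix (f S) id).submatrix σ id := rfl
        rw [this, det_permute]
        simp only [transpose_apply, submatrix_apply, id, Function.comp, Units.smul_def,
          zsmul_eq_mul]
        ring
    · intro g hg
      simp only [mem_filter, mem_univ, true_and] at hg
      simp [mem_powersetCard, card_image_of_injective _ hg, card_univ]
  · intro g _ h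
    contrapose! h
    obtain ⟨a, b, hab, hne⟩ : ∃ a b, g a = g b ∧ a ≠ b := by
      simpa [Function.Injective] using h
    rw [det_zero_of_row_eq hne (by ext j; simp [hab]), mul_zero]

/-- A cofactor is an entry of the adjugate. Minors thereby become determinants of full square
matrices, which can be factored without reindexing. -/
theorem det_submatrix_succAbove {R : Type*} [CommRing R] {k : ℕ}
    (Q : Matrix (Fin (k + 1)) (Fin (k + 1)) R) (r c : Fin (k + 1)) :
    (Q.submatrix r.succAbove c.succAbove).det =
      (-1) ^ ((r : ℕ) + c) * (Q.updateRow r (Pi.single c 1)).det := by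
  rw [← adjugate_apply, adjugate_fin_succ_eq_det_submatrix, ← mul_assoc, ← pow_add,
    Even.neg_one_pow ⟨_, rfl⟩, one_mul]

theorem det_submatrix_succAbove_succAbove {R : Type*} [CommRing R] {k : ℕ}
    (Q : Matrix (Fin (k + 2)) (Fin (k + 2)) R) (r c : Fin (k + 2)) (i j : Fin (k + 1)) :
    (Q.submatrix (r.succAbove ∘ i.succAbove) (c.succAbove ∘ j.succAbove)).det =
      (-1) ^ ((i : ℕ) + j) * ((-1) ^ ((r : ℕ) + c) *
        ((Q.updateRow (r.succAbove i) (Pi.single (c.succAbove j) 1)).updateRow r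
          (Pi.single c 1)).det) := by
  have h : (Q.submatrix r.succAbove c.succAbove).updateRow i (Pi.single j 1) =
      (Q.updateRow (r.succAbove i) (Pi.single (c.succAbove j) 1)).submatrix
        r.succAbove c.succAbove := by
    ext a b
    by_cases ha : a = i
    · subst ha
      simp [Pi.single_apply]
    · simp [updateRow_apply, ha]
  rw [← submatrix_submatrix, det_submatrix_succAbove, h, det_submatrix_succAbove]

open Classical in
/-- The matrix that, on the part of `r` and `c`, replaces the row `c` by the unit vector at `r` and
the row `r` by the negative of the indicator of the part. -/
noncomputable def exchangeMatrix {α : Type*} (P : Setoid α) (c r : α) : Matrix α α ℤ :=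
  Matrix.of fun x y => if x = c then (if y = r then 1 else 0) else
    if x = r then (if P r y then -1 else 0) else if x = y then 1 else 0

theorem det_exchangeMatrix {α : Type*} [Fintype α] [DecidableEq α] (P : Setoid α) (c r : α)
    (h : P r c) : (exchangeMatrix P c r).det = 1 := by
  classical
  by_cases hcr : c = r
  · subst hcr
    have : exchangeMatrix P c c = 1 := by
      ext x y
      simp only [exchangeMatrix, Matrix.of_apply, Matrix.one_apply]
      split_ifs <;> simp_all
    rw [this, det_one]
  · let v : α → ℤ := fun x => if x = r then -1 else 1
    let A : Matrix α α ℤ :=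
      Matrix.of fun x y => v x * (1 : Matrix α α ℤ).submatrix (Equiv.swap c r) id x y
    have hA : A.det = 1 := by
      rw [det_mul_column, det_permute, Equiv.Perm.sign_swap hcr, Finset.prod_ite_eq']
      simp
    -- `A` is a transposition with one row negated, so its determinant is 1. Row `r` of `A` is minus
    -- the unit vector at `c`; subtracting from it the rows of the other members of the part gives
    -- minus the indicator of the part.
    have hK : exchangeMatrix P c r = A.updateRow r
        (∑ k, (if k = r then 1 else if P r k then -1 else 0 : ℤ) • A k) := by
      ext x y
      by_cases hx : x = r
      · subst hx
        rw [updateRow_self, Finset.sum_apply, Finset.sum_eq_single (Equiv.swap c x y)]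
        · by_cases hy : y = x
          · subst hy
            simp [exchangeMatrix, A, v, Ne.symm hcr, hcr, h, Matrix.one_apply]
          · by_cases hyc : y = c
            · subst hyc
              simp [exchangeMatrix, A, v, Ne.symm hcr, h, Matrix.one_apply]
            · rw [Equiv.swap_apply_of_ne_of_ne hyc hy]
              simp [exchangeMatrix, A, v, Ne.symm hcr, hy, Matrix.one_apply,
                Equiv.swap_apply_of_ne_of_ne hyc hy]
        · intro k _ hk
          have : Equiv.swap c x k ≠ y := fun h => hk (by rw [← h]; simp)
          simp [A, Matrix.one_apply, this]
        · simp
      · rw [updateRow_ne hx]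
        by_cases hxc : x = c
        · subst hxc
          simp [exchangeMatrix, A, v, Ne.symm hx, Matrix.one_apply, eq_comm]
        · simp [exchangeMatrix, A, v, hx, hxc, Matrix.one_apply,
            Equiv.swap_apply_of_ne_of_ne hxc hx]
    rw [hK, det_updateRow_sum, hA]
    simp

/-- Selecting distinguished rows and columns leaves `D` alone, so it commutes with taking the Schur
complement. Identity, constant and `succAbove` selections give the determinants in the expansion
identity. -/
theorem det_submatrix_sumMap_of_invertible {R κ₁ κ₂ W : Type*} [CommRing R] [Fintype κ₁]
    [DecidableEq κ₁] [Fintype W] [DecidableEq W]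
    (A : Matrix κ₂ κ₂ R) (B : Matrix κ₂ W R) (C : Matrix W κ₂ R) (D : Matrix W W R) [Invertible D]
    (f g : κ₁ → κ₂) :
    ((fromBlocks A B C D).submatrix (Sum.map f id) (Sum.map g id)).det =
      D.det * ((A - B * ⅟D * C).submatrix f g).det := by
  have : (fromBlocks A B C D).submatrix (Sum.map f id) (Sum.map g id) =
      fromBlocks (A.submatrix f g) (B.submatrix f id) (C.submatrix id g) D := by
    ext (i | i) (j | j) <;> rfl
  rw [this, det_fromBlocks₂₂]
  rfl

/-- The column expansion identity for the Schur complement of an invertible block. -/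
theorem column_expansion_of_invertible {R W : Type*} [CommRing R] [Fintype W]
    {k : ℕ} (M : Matrix (Fin (k + 1) ⊕ W) (Fin (k + 1) ⊕ W) R)
    (hM : IsUnit (detCore M)) (j : Fin (k + 1)) [DecidableEq (Fin (k + 1) ⊕ W)] :
    M.det * detCore M = ∑ i : Fin (k + 1), (-1) ^ ((i : ℕ) + j) *
      (detDrop M i j * detKeep M i j) := by
  classical
  obtain ⟨A, B, C, D, rfl⟩ : ∃ A B C D, M = fromBlocks A B C D :=
    ⟨_, _, _, _, (fromBlocks_toBlocks M).symm⟩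
  have hcore : detCore (fromBlocks A B C D) = D.det := rfl
  rw [hcore] at hM
  have := Matrix.invertibleOfIsUnitDet D hM
  have h1 := det_submatrix_sumMap_of_invertible A B C D id id
  simp only [Sum.map_id_id, submatrix_id_id] at h1
  have h2 : ∀ i, detKeep (fromBlocks A B C D) i j = D.det * (A - B * ⅟D * C) i j := by
    intro i
    refine Eq.trans ?_ ((det_submatrix_sumMap_of_invertible A B C D (fun _ : Unit => i)
      (fun _ : Unit => j)).trans ?_)
    · unfold detKeep; congr!
    · simp
  have h3 : ∀ i, detDrop (fromBlocks A B C D) i j =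
      D.det * ((A - B * ⅟D * C).submatrix i.succAbove j.succAbove).det := by
    intro i
    refine Eq.trans ?_ (det_submatrix_sumMap_of_invertible A B C D i.succAbove j.succAbove)
    unfold detDrop; congr!
  have h4 : (fromBlocks A B C D).det = D.det * (A - B * ⅟D * C).det := by
    rw [← h1]; congr!
  rw [hcore, h4, det_succ_column (A - B * ⅟D * C) j, mul_sum, sum_mul]
  refine sum_congr rfl fun i _ => ?_
  rw [h2, h3]
  ring

theorem detCore_map {R S W : Type*} [CommRing R] [CommRing S] [Fintype W] {k : ℕ} (φ : R →+* S)
    (M : Matrix (Fin k ⊕ W) (Fin k ⊕ W) R) : detCore (M.map φ) = φ (detCore M) := by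
  classical
  simp only [detCore, RingHom.map_det]; rfl

theorem detDrop_map {R S W : Type*} [CommRing R] [CommRing S] [Fintype W] {k : ℕ} (φ : R →+* S)
    (M : Matrix (Fin (k + 1) ⊕ W) (Fin (k + 1) ⊕ W) R) (i j : Fin (k + 1)) :
    detDrop (M.map φ) i j = φ (detDrop M i j) := by
  classical
  simp only [detDrop, RingHom.map_det]; rfl

theorem detKeep_map {R S W : Type*} [CommRing R] [CommRing S] [Fintype W] {k : ℕ} (φ : R →+* S)
    (M : Matrix (Fin k ⊕ W) (Fin k ⊕ W) R) (i j : Fin k) :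
    detKeep (M.map φ) i j = φ (detKeep M i j) := by
  classical
  simp only [detKeep, RingHom.map_det]; rfl

/-- The column expansion identity over a domain. The distinguished block is made invertible by
adding a variable to its diagonal. -/
theorem column_expansion {R W : Type*} [CommRing R] [IsDomain R] [Fintype W]
    {k : ℕ} (M : Matrix (Fin (k + 1) ⊕ W) (Fin (k + 1) ⊕ W) R) (j : Fin (k + 1))
    [DecidableEq (Fin (k + 1) ⊕ W)] :
    M.det * detCore M = ∑ i : Fin (k + 1), (-1) ^ ((i : ℕ) + j) *
      (detDrop M i j * detKeep M i j) := by
  classical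
  let N : Matrix (Fin (k + 1) ⊕ W) (Fin (k + 1) ⊕ W) (Polynomial R) :=
    M.map Polynomial.C + fromBlocks 0 0 0 (scalar W Polynomial.X)
  have hN : M = N.map (Polynomial.evalRingHom 0) := by
    ext (a | a) (b | b) <;> simp [N, scalar_apply, diagonal_apply, apply_ite]
  -- A characteristic polynomial is monic, hence nonzero, hence a unit in the fraction field of
  -- `Polynomial R`.
  have hcore : detCore N = (-(M.submatrix Sum.inr Sum.inr)).charpoly := by
    rw [charpoly, charmatrix]
    unfold detCore
    congr! 1
    ext a b
    simp [N, add_comm]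
  have key : N.det * detCore N = ∑ i : Fin (k + 1), (-1) ^ ((i : ℕ) + j) *
      (detDrop N i j * detKeep N i j) := by
    let φ := algebraMap (Polynomial R) (FractionRing (Polynomial R))
    have hφ : Function.Injective φ := IsFractionRing.injective _ _
    apply hφ
    have := column_expansion_of_invertible (N.map φ) (by
      rw [detCore_map, hcore]
      exact (((map_ne_zero_iff _ hφ).2 (charpoly_monic _).ne_zero)).isUnit) j
    simp only [detCore_map, detDrop_map, detKeep_map] at this
    simp only [map_mul, map_sum, map_pow, map_neg, map_one]
    rw [← this, RingHom.map_det]; rfl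
  have := congrArg (Polynomial.evalRingHom (0 : R)) key
  simp only [map_mul, map_sum, map_pow, map_neg, map_one] at this
  rw [hN]
  simp only [detCore_map, detDrop_map, detKeep_map]
  rw [← this, RingHom.map_det]; rfl

end LinearAlgebra

/-! ### Incidence minors and rooted forests -/

section Incidence

open Matrix Finset
open scoped Classical

variable {V : Type*}

/-- The graph with the given set of edges. -/
abbrev edgeGraph (F : Finset (Sym2 V)) : SimpleGraph V :=
  SimpleGraph.fromEdgeSet (F : Set (Sym2 V))

/-- The incidence vector of an edge, with an arbitrary orientation. -/
noncomputable def inc (e : Sym2 V) (x : V) : ℤ :=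
  (if (Quot.out e).1 = x then 1 else 0) - (if (Quot.out e).2 = x then 1 else 0)

/-- `Quot.out` may return either orientation. The unknown sign is `ε`, and `ε * ε = 1` is all that
is needed of it. -/
theorem inc_mk (x y : V) : ∃ ε : ℤ, ε * ε = 1 ∧
    ∀ z, inc s(x, y) z = ε * ((if x = z then 1 else 0) - (if y = z then 1 else 0)) := by
  have h : s((Quot.out s(x, y)).1, (Quot.out s(x, y)).2) = s(x, y) := Quot.out_eq _
  rcases Sym2.eq_iff.1 h with h | h
  · exact ⟨1, by norm_num, fun z => by rw [inc, h.1, h.2, one_mul]⟩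
  · exact ⟨-1, by norm_num, fun z => by rw [inc, h.1, h.2]; ring⟩

/-- The two ends of an edge contribute opposite signs, and `C` contains both or neither. -/
theorem sum_inc [Fintype V] (C : V → Prop) [DecidablePred C] (x y : V) (h : C x ↔ C y) :
    ∑ a, (if C a then 1 else 0) * inc s(x, y) a = 0 := by
  obtain ⟨ε, -, hε⟩ := inc_mk x y
  simp only [hε]
  have hs : ∀ w, ∑ a, (if C a then (1 : ℤ) else 0) * (ε * (if w = a then 1 else 0)) =
      ε * (if C w then 1 else 0) := by
    intro w
    rw [sum_eq_single w (fun a _ ha => by simp [Ne.symm ha]) (by simp), if_pos rfl]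
    ring
  simp only [mul_sub, sum_sub_distrib, hs]
  rw [if_congr h rfl rfl, sub_self]

theorem sum_inc_of_mem [Fintype V] {F : Finset (Sym2 V)} {C : V → Prop} [DecidablePred C]
    (hC : ∀ x y, (edgeGraph F).Adj x y → (C x ↔ C y)) {e : Sym2 V} (he : e ∈ F) :
    ∑ a, (if C a then 1 else 0) * inc e a = 0 := by
  induction e using Sym2.ind with
  | _ x y =>
    refine sum_inc C x y ?_
    by_cases h : x = y
    · rw [h]
    · exact hC x y (by simp [h, he])

/-- Two vertices of a component bound an integral chain. -/
theorem exists_chain {F : Finset (Sym2 V)} {x y : V} (h : (edgeGraph F).Reachable x y) :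
    ∃ z : Sym2 V → ℤ, ∀ a, ∑ e ∈ F, z e * inc e a =
      (if x = a then 1 else 0) - (if y = a then 1 else 0) := by
  rw [SimpleGraph.reachable_iff_reflTransGen] at h
  induction h with
  | refl => exact ⟨0, by simp⟩
  | @tail b c _ hbc ih =>
    obtain ⟨z, hz⟩ := ih
    obtain ⟨ε, hε1, hε⟩ := inc_mk b c
    have hmem : s(b, c) ∈ F := by simpa using ((SimpleGraph.fromEdgeSet_adj _).1 hbc).1
    refine ⟨z + Pi.single s(b, c) ε, fun a => ?_⟩
    simp only [Pi.add_apply, add_mul, sum_add_distrib, hz]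
    rw [sum_eq_single_of_mem _ hmem fun e _ hne => by simp [hne], Pi.single_eq_same, hε,
      ← mul_assoc, hε1]
    ring

/-- The submatrix of the incidence matrix with the given rows and columns. -/
noncomputable def incMatrix {n κ : Type*} (ρ : n → V) (f : κ → Sym2 V) : Matrix n κ ℤ :=
  Matrix.of fun i j => inc (f j) (ρ i)

/-- Every component contains exactly one vertex outside the range of `ρ`. -/
def UniquelyRooted {n : Type*} (F : Finset (Sym2 V)) (ρ : n → V) : Prop :=
  ∀ x, ∃! u, u ∉ Set.range ρ ∧ (edgeGraph F).Reachable x u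

section

variable {n κ : Type*} [Fintype n] [DecidableEq n] [Fintype κ]
  {F : Finset (Sym2 V)} {ρ : n → V} {f : κ → Sym2 V}

theorem sum_comp_enumeration {M : Type*} [AddCommMonoid M] (hf : Function.Injective f)
    (himg : univ.image f = F) (g : Sym2 V → M) : ∑ j, g (f j) = ∑ e ∈ F, g e := by
  rw [← himg, sum_image fun a _ b _ h => hf h]

theorem prod_comp_enumeration {M : Type*} [CommMonoid M] (hf : Function.Injective f)
    (himg : univ.image f = F) (g : Sym2 V → M) : ∏ j, g (f j) = ∏ e ∈ F, g e := by
  rw [← himg, prod_image fun a _ b _ h => hf h]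

omit [Fintype n] in
-- Column `k` of `Z` is a chain from `ρ k` to the root of its component. The root is not a row, so
-- only the entry at `ρ k` of its boundary is seen.
theorem exists_incMatrix_mul_eq_one (hρ : Function.Injective ρ) (hf : Function.Injective f)
    (himg : univ.image f = F) (h : UniquelyRooted F ρ) :
    ∃ Z : Matrix κ n ℤ, incMatrix ρ f * Z = 1 := by
  choose u hu _ using h
  choose z hz using fun i => exists_chain (hu (ρ i)).2
  refine ⟨Matrix.of fun j i => z i (f j), ?_⟩
  ext i k
  simp only [Matrix.mul_apply, incMatrix, Matrix.of_apply]
  have : u (ρ k) ≠ ρ i := fun h => (hu (ρ k)).1 ⟨i, h.symm⟩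
  rw [sum_comp_enumeration hf himg (fun e => inc e (ρ i) * z k e)]
  simp only [mul_comm (inc _ _), hz, if_neg this, sub_zero, Matrix.one_apply, hρ.eq_iff]
  simp only [eq_comm]

theorem det_incMatrix_mul_self {f : n → Sym2 V} (hρ : Function.Injective ρ)
    (hf : Function.Injective f) (himg : univ.image f = F) (h : UniquelyRooted F ρ) :
    (incMatrix ρ f).det * (incMatrix ρ f).det = 1 := by
  obtain ⟨Z, hZ⟩ := exists_incMatrix_mul_eq_one hρ hf himg h
  exact Int.isUnit_mul_self (Matrix.isUnit_det_of_right_inverse hZ)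

/-- A component without root has an indicator in the left kernel; a chain between two roots of one
component is in the right kernel. -/
theorem uniquelyRooted_of_det_ne_zero [Fintype V] {f : n → Sym2 V} (hρ : Function.Injective ρ)
    (hf : Function.Injective f) (himg : univ.image f = F) (h : (incMatrix ρ f).det ≠ 0) :
    UniquelyRooted F ρ := by
  intro x
  apply existsUnique_of_exists_of_unique
  · by_contra! hx
    have hy : (fun i => if (edgeGraph F).Reachable x (ρ i) then (1 : ℤ) else 0) = 0 := by
      apply eq_zero_of_vecMul_eq_zero h
      ext j
      have hmem : f j ∈ F := by rw [← himg]; exact mem_image_of_mem _ (mem_univ _)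
      have := sum_inc_of_mem (C := fun a => (edgeGraph F).Reachable x a)
        (fun a b hab => ⟨fun h => h.trans hab.reachable, fun h => h.trans hab.symm.reachable⟩)
        hmem
      rw [← sum_subset (subset_univ (univ.image ρ)) fun a _ ha => ?_,
        sum_image fun a _ b _ h => hρ h] at this
      · simpa [vecMul, dotProduct, incMatrix] using this
      · rw [if_neg fun hr => hx a (by simpa using ha) hr, zero_mul]
    have hxr : x ∈ Set.range ρ := by
      by_contra hn
      exact hx x hn (SimpleGraph.Reachable.refl _)
    obtain ⟨i, rfl⟩ := hxr
    simpa using congrFun hy i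
  · rintro u u' ⟨hu, hxu⟩ ⟨hu', hxu'⟩
    obtain ⟨z, hz⟩ := exists_chain (hxu.symm.trans hxu')
    have h0 : (fun j => z (f j)) = 0 := by
      apply eq_zero_of_mulVec_eq_zero h
      ext i
      have : ∑ j, z (f j) * inc (f j) (ρ i) = 0 := by
        rw [sum_comp_enumeration hf himg (fun e => z e * inc e (ρ i)), hz,
          if_neg fun h => hu ⟨i, h.symm⟩, if_neg fun h => hu' ⟨i, h.symm⟩, sub_zero]
      simpa [mulVec, dotProduct, incMatrix, mul_comm] using this
    have := hz u
    rw [← sum_comp_enumeration hf himg (fun e => z e * inc e u),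
      sum_eq_zero fun j _ => by rw [show z (f j) = 0 from congrFun h0 j, zero_mul]] at this
    by_contra hne
    simp [Ne.symm hne] at this

/-- If an edge is not a bridge, closing up a chain that avoids it gives a nonzero cycle, which lies
in the kernel whatever the rows are. -/
theorem isAcyclic_of_det_ne_zero {f : n → Sym2 V}
    (hf : Function.Injective f) (himg : univ.image f = F) (h : (incMatrix ρ f).det ≠ 0) :
    (edgeGraph F).IsAcyclic := by
  rw [SimpleGraph.isAcyclic_iff_forall_adj_isBridge]
  intro x y hxy
  rw [SimpleGraph.isBridge_iff, SimpleGraph.deleteEdges_fromEdgeSet]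
  intro hr
  have hmem : s(x, y) ∈ F := by simpa using ((SimpleGraph.fromEdgeSet_adj _).1 hxy).1
  have hr' : (edgeGraph (F.erase s(x, y))).Reachable x y := by
    rw [edgeGraph, coe_erase]; exact hr
  obtain ⟨z, hz⟩ := exists_chain hr'
  obtain ⟨ε, hε1, hε⟩ := inc_mk x y
  -- The value of `z` at the removed edge is arbitrary and is overwritten by the one that closes the
  -- chain.
  let z' : Sym2 V → ℤ := Function.update z s(x, y) (-ε)
  have hz' : ∀ a, ∑ e ∈ F, z' e * inc e a = 0 := by
    intro a
    rw [← add_sum_erase _ _ hmem, sum_congr rfl fun e he => by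
      rw [show z' e = z e from Function.update_of_ne (ne_of_mem_erase he) _ _], hz,
      show z' s(x, y) = -ε from Function.update_self _ _ _, hε, neg_mul, ← mul_assoc, hε1]
    ring
  have h0 : (fun j => z' (f j)) = 0 := by
    apply eq_zero_of_mulVec_eq_zero h
    ext i
    have := hz' (ρ i)
    rw [← sum_comp_enumeration hf himg (fun e => z' e * inc e (ρ i))] at this
    simpa [mulVec, dotProduct, incMatrix, mul_comm] using this
  rw [← himg] at hmem
  obtain ⟨j, -, hj⟩ := mem_image.1 hmem
  have := congrFun h0 j
  simp only [hj, z', Function.update_self, Pi.zero_apply] at this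
  rw [neg_eq_zero.1 this] at hε1
  simp at hε1

/-- Every edge is a bridge. Pairing the zero boundary of `z` with the indicator of one side of the
cut kills all other edges and leaves `±z e`. -/
theorem eq_zero_of_isAcyclic [Fintype V] (hF : (edgeGraph F).IsAcyclic) {z : Sym2 V → ℤ}
    (hz : ∀ a, ∑ e ∈ F, z e * inc e a = 0) (hdiag : ∀ e ∈ F, ¬ e.IsDiag) {e : Sym2 V}
    (he : e ∈ F) : z e = 0 := by
  induction e using Sym2.ind with
  | _ x y =>
    have hxy : x ≠ y := hdiag _ he
    have hadj : (edgeGraph F).Adj x y := by simp [hxy, he]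
    have hb := SimpleGraph.isBridge_iff.1
      (SimpleGraph.isAcyclic_iff_forall_adj_isBridge.1 hF hadj)
    rw [SimpleGraph.deleteEdges_fromEdgeSet] at hb
    have hb' : ¬ (edgeGraph (F.erase s(x, y))).Reachable x y := by
      rw [edgeGraph, coe_erase]; exact hb
    set H := edgeGraph (F.erase s(x, y)) with hH
    obtain ⟨ε, hε1, hε⟩ := inc_mk x y
    have h1 : ∑ a, (if H.Reachable x a then 1 else 0) * ∑ e ∈ F, z e * inc e a = 0 :=
      sum_eq_zero fun a _ => by rw [hz, mul_zero]
    have h2 : ∑ a, (if H.Reachable x a then 1 else 0) * ∑ e ∈ F, z e * inc e a =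
        ∑ e ∈ F, z e * ∑ a, (if H.Reachable x a then 1 else 0) * inc e a := by
      simp only [mul_sum]
      rw [sum_comm]
      exact sum_congr rfl fun _ _ => sum_congr rfl fun _ _ => by ring
    rw [h2, ← add_sum_erase _ _ he, sum_eq_zero (s := F.erase s(x, y)) fun e he => by
      rw [sum_inc_of_mem (F := F.erase s(x, y)) (fun a b hab => ⟨fun h => h.trans hab.reachable,
        fun h => h.trans hab.symm.reachable⟩) he, mul_zero], add_zero] at h1
    have h3 : ∑ a, (if H.Reachable x a then 1 else 0) * inc s(x, y) a = ε := by
      simp only [hε]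
      simp [mul_sub, sum_sub_distrib, hb']
    rw [h3] at h1
    have : z s(x, y) * (ε * ε) = 0 := by rw [← mul_assoc, h1, zero_mul]
    simpa [hε1] using this

/-- A spanning forest has as many edges as there are vertices that are not roots. -/
theorem card_eq_of_uniquelyRooted [Fintype V] (hF : (edgeGraph F).IsAcyclic)
    (hdiag : ∀ e ∈ F, ¬ e.IsDiag) (hρ : Function.Injective ρ) (h : UniquelyRooted F ρ) :
    F.card = Fintype.card n := by
  let f : F → Sym2 V := Subtype.val
  have hf : Function.Injective f := Subtype.val_injective
  have himg : univ.image f = F := by ext; simp [f]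
  have hker : ∀ z : F → ℤ, incMatrix ρ f *ᵥ z = 0 → z = 0 := by
    intro z hz
    let z' : Sym2 V → ℤ := fun e => if he : e ∈ F then z ⟨e, he⟩ else 0
    have hzz : ∀ j : F, z' (f j) = z j := fun j => by simp [z', f]
    have hρz : ∀ i, ∑ e ∈ F, z' e * inc e (ρ i) = 0 := by
      intro i
      have := congrFun hz i
      rw [← sum_comp_enumeration hf himg (fun e => z' e * inc e (ρ i))]
      simpa [hzz, mulVec, dotProduct, incMatrix, mul_comm] using this
    -- The boundary also vanishes at a root: it sums to zero over the component, whose other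
    -- vertices are all rows.
    have hall : ∀ a, ∑ e ∈ F, z' e * inc e a = 0 := by
      intro u
      by_cases hu : u ∈ Set.range ρ
      · obtain ⟨i, rfl⟩ := hu
        exact hρz i
      have h1 : ∑ a, (if (edgeGraph F).Reachable u a then 1 else 0) *
          ∑ e ∈ F, z' e * inc e a = ∑ e ∈ F, z' e * inc e u := by
        rw [sum_eq_single u]
        · simp
        · intro a _ hau
          by_cases ha : a ∈ Set.range ρ
          · obtain ⟨i, rfl⟩ := ha
            rw [hρz, mul_zero]
          · rw [if_neg fun hr => hau ((h u).unique ⟨ha, hr⟩ ⟨hu, SimpleGraph.Reachable.refl _⟩),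
              zero_mul]
        · simp
      rw [← h1]
      simp only [mul_sum]
      rw [sum_comm]
      refine sum_eq_zero fun e he => ?_
      have := sum_inc_of_mem (C := fun a => (edgeGraph F).Reachable u a)
        (fun a b hab => ⟨fun h => h.trans hab.reachable, fun h => h.trans hab.symm.reachable⟩) he
      simp only [mul_left_comm _ (z' e)]
      rw [← mul_sum, this, mul_zero]
    ext j
    rw [← hzz, Pi.zero_apply]
    exact eq_zero_of_isAcyclic hF hall hdiag j.2
  obtain ⟨Z, hZ⟩ := exists_incMatrix_mul_eq_one hρ hf himg h
  -- A right inverse together with a trivial kernel gives a two-sided inverse, which forces the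
  -- matrix to be square.
  have hZ' : Z * incMatrix ρ f = 1 := by
    rw [← sub_eq_zero]
    ext i j
    have := hker (fun k => (Z * incMatrix ρ f - (1 : Matrix F F ℤ)) k j) (by
      have h0 : incMatrix ρ f * (Z * incMatrix ρ f - (1 : Matrix F F ℤ)) = 0 := by
        rw [Matrix.mul_sub, ← Matrix.mul_assoc, hZ, Matrix.one_mul, Matrix.mul_one, sub_self]
      ext i
      exact congrFun (congrFun h0 i) j)
    exact congrFun this i
  have := square_of_invertible _ _ hZ hZ'
  rw [this, Fintype.card_coe]

end

end Incidence

/-! ### The all minors matrix tree theorem -/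

section AllMinors

open Matrix Finset
open scoped Classical

variable {V : Type*}

/-- The matrix expressing the incidence rows outside one root set through those outside
another. -/
noncomputable def transferMatrix {α : Type*} (P : Setoid α) (U : Finset α) : Matrix α α ℤ :=
  Matrix.of fun x y => if x ∈ U then (if P x y then -1 else 0) else if x = y then 1 else 0

/-- Over a component the incidence rows sum to zero, so the row of its root is minus the sum of its
other rows. -/
theorem incMatrix_eq_mul [Fintype V] {n κ : Type*} [Fintype n] {F : Finset (Sym2 V)} {ρ : n → V}
    (hρ : Function.Injective ρ) (h : UniquelyRooted F ρ) {f : κ → Sym2 V} (hf : ∀ j, f j ∈ F)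
    (σ : n → V) :
    incMatrix σ f = (Matrix.of fun i k => if σ i ∈ Set.range ρ then if σ i = ρ k then 1 else 0
      else if (edgeGraph F).Reachable (σ i) (ρ k) then -1 else 0) * incMatrix ρ f := by
  ext i j
  simp only [incMatrix, Matrix.mul_apply, Matrix.of_apply]
  by_cases hi : σ i ∈ Set.range ρ
  · obtain ⟨k, hk⟩ := hi
    have : σ i ∈ Set.range ρ := ⟨k, hk⟩
    rw [sum_eq_single k]
    · simp [← hk]
    · intro l _ hl
      simp [← hk, hρ.eq_iff, Ne.symm hl]
    · simp
  · have h0 := sum_inc_of_mem (C := fun a => (edgeGraph F).Reachable (σ i) a)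
      (fun a b hab => ⟨fun h => h.trans hab.reachable, fun h => h.trans hab.symm.reachable⟩)
      (hf j)
    rw [← sum_add_sum_compl (univ.image ρ), sum_image fun a _ b _ h => hρ h,
      sum_eq_single_of_mem (s := (univ.image ρ)ᶜ) (σ i) (by simpa using hi) fun a ha hai => ?_,
      if_pos (SimpleGraph.Reachable.refl _), one_mul, add_comm] at h0
    · rw [eq_neg_of_add_eq_zero_left h0, ← sum_neg_distrib]
      refine sum_congr rfl fun k _ => ?_
      rw [if_neg hi]
      split_ifs <;> ring
    · have ha' : a ∉ Set.range ρ := by simpa using ha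
      rw [if_neg fun hr => hai ((h (σ i)).unique ⟨ha', hr⟩ ⟨hi, SimpleGraph.Reachable.refl _⟩),
        zero_mul]

/-- The weight of an unordered pair of vertices: its variable, or `0` for a non-edge. -/
noncomputable def edgeWeight (G : SimpleGraph V) (e : Sym2 V) : MvPolynomial (Sym2 V) ℤ :=
  if e ∈ G.edgeSet then MvPolynomial.X e else 0

/-- This is the factorisation to which Cauchy-Binet applies. The sum may run over all unordered
pairs because non-edges have weight zero. -/
theorem lap_eq_sum [Fintype V] (G : SimpleGraph V) (x y : V) :
    lap G x y = ∑ e : Sym2 V, edgeWeight G e * ((inc e x : ℤ) * (inc e y : ℤ)) := by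
  rw [lap, Matrix.of_apply]
  split_ifs with h
  · subst h
    rw [← sum_subset (subset_univ ((univ.erase x).image fun z => s(x, z)))]
    · rw [sum_image fun a _ b _ h => Sym2.congr_right.1 h]
      refine sum_congr rfl fun z hz => ?_
      have hzx := ne_of_mem_erase hz
      obtain ⟨ε, hε1, hε⟩ := inc_mk x z
      have : inc s(x, z) x * inc s(x, z) x = 1 := by rw [hε, if_pos rfl, if_neg hzx]; linarith
      rw [← Int.cast_mul, this]
      simp [wt, edgeWeight]
    · intro e _ he
      induction e using Sym2.ind with
      | _ a b =>
        obtain ⟨ε, hε1, hε⟩ := inc_mk a b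
        by_cases hab : a = b
        · subst hab; simp [hε]
        · have ha : a ≠ x := by
            rintro rfl
            exact he (mem_image.2 ⟨b, by simp [Ne.symm hab], rfl⟩)
          have hb : b ≠ x := by
            rintro rfl
            exact he (mem_image.2 ⟨a, by simp [hab], Sym2.eq_swap⟩)
          simp [hε, ha, hb]
  · rw [sum_eq_single s(x, y)]
    · obtain ⟨ε, hε1, hε⟩ := inc_mk x y
      have : inc s(x, y) x * inc s(x, y) y = -1 := by
        simp only [hε, if_neg h, if_neg (Ne.symm h), if_pos]; linarith
      rw [← Int.cast_mul, this]
      simp [wt, edgeWeight]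
    · intro e _ he
      induction e using Sym2.ind with
      | _ a b =>
        obtain ⟨ε, hε1, hε⟩ := inc_mk a b
        have h1 : inc s(a, b) x * inc s(a, b) y = 0 := by
          rw [hε, hε]
          by_cases hax : a = x
          · subst hax
            have hby : b ≠ y := by rintro rfl; exact he rfl
            simp [h, hby]
          · by_cases hbx : b = x
            · subst hbx
              have hay : a ≠ y := by rintro rfl; exact he Sym2.eq_swap
              simp [h, hay]
            · simp [hax, hbx]
        rw [← Int.cast_mul, h1]
        simp
    · simp

variable {m : ℕ}

/-- The partition of the marked vertices induced by the components of a set of edges. -/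
def inducedPartition (v : Fin m ↪ V) (F : Finset (Sym2 V)) : Setoid (Fin m) :=
  (edgeGraph F).reachableSetoid.comap v

theorem inducedPartition_apply {v : Fin m ↪ V} {F : Finset (Sym2 V)} {a b : Fin m} :
    inducedPartition v F a b ↔ (edgeGraph F).Reachable (v a) (v b) := Iff.rfl

/-- Injectivity of `φ` makes the forest determine its partition, so each `F` is counted for at most
one `P`. -/
theorem IsForestFor.eq_inducedPartition {G : SimpleGraph V} {v : Fin m ↪ V} {P : Setoid (Fin m)}
    {F : Finset (Sym2 V)} (h : IsForestFor G v P F) : P = inducedPartition v F := by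
  obtain ⟨-, -, φ, hφ⟩ := h
  ext a b
  rw [inducedPartition_apply, ← SimpleGraph.ConnectedComponent.eq, ← hφ, ← hφ,
    φ.injective.eq_iff, Quotient.eq]

theorem IsForestFor.exists_reachable {G : SimpleGraph V} {v : Fin m ↪ V} {P : Setoid (Fin m)}
    {F : Finset (Sym2 V)} (h : IsForestFor G v P F) (x : V) :
    ∃ a, (edgeGraph F).Reachable x (v a) := by
  obtain ⟨-, -, φ, hφ⟩ := h
  obtain ⟨a, ha⟩ := Quotient.exists_rep (φ.symm ((edgeGraph F).connectedComponentMk x))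
  refine ⟨a, SimpleGraph.ConnectedComponent.exact ?_⟩
  rw [← hφ]
  exact (φ.symm_apply_eq.1 ha.symm)

/-- Every component contains exactly one marked vertex with index in `U`. -/
def UniquelyRootedAt (v : Fin m ↪ V) (U : Finset (Fin m)) (F : Finset (Sym2 V)) : Prop :=
  ∀ x, ∃! a, a ∈ U ∧ (edgeGraph F).Reachable x (v a)

/-- The vertices given by a list of marked vertices and all unmarked vertices. -/
def rowVertex {ι : Type*} (v : Fin m ↪ V) (p : ι → Fin m) : ι ⊕ Unmarked v → V :=
  Sum.elim (fun i => v (p i)) Subtype.val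

theorem rowVertex_injective {ι : Type*} (v : Fin m ↪ V) {p : ι → Fin m}
    (hp : Function.Injective p) : Function.Injective (rowVertex v p) := by
  rintro (a | a) (b | b) h
  · exact congrArg _ (hp (v.injective h))
  · exact absurd ⟨p a, h⟩ b.2
  · exact absurd ⟨p b, h.symm⟩ a.2
  · exact congrArg _ (Subtype.ext h)

theorem notMem_range_rowVertex {ι : Type*} {v : Fin m ↪ V} {p : ι → Fin m} {U : Finset (Fin m)}
    (hU : ∀ a, a ∈ U ↔ a ∉ Set.range p) {x : V} :
    x ∉ Set.range (rowVertex v p) ↔ ∃ a ∈ U, v a = x := by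
  constructor
  · intro h
    have hx : x ∈ Set.range v := by
      by_contra hn
      exact h ⟨Sum.inr ⟨x, hn⟩, rfl⟩
    obtain ⟨a, rfl⟩ := hx
    refine ⟨a, (hU a).2 ?_, rfl⟩
    rintro ⟨i, rfl⟩
    exact h ⟨Sum.inl i, rfl⟩
  · rintro ⟨a, ha, rfl⟩ ⟨i | i, hi⟩
    · exact (hU a).1 ha ⟨i, v.injective hi⟩
    · exact i.2 ⟨a, hi.symm⟩

theorem uniquelyRooted_rowVertex {ι : Type*} {v : Fin m ↪ V} {p : ι → Fin m} {U : Finset (Fin m)}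
    (hU : ∀ a, a ∈ U ↔ a ∉ Set.range p) {F : Finset (Sym2 V)} :
    UniquelyRooted F (rowVertex v p) ↔ UniquelyRootedAt v U F := by
  refine forall_congr' fun x => ?_
  simp only [notMem_range_rowVertex hU]
  constructor
  · rintro ⟨u, ⟨⟨a, ha, rfl⟩, hx⟩, hu⟩
    exact ⟨a, ⟨ha, hx⟩, fun b hb => v.injective (hu _ ⟨⟨b, hb.1, rfl⟩, hb.2⟩)⟩
  · rintro ⟨a, ⟨ha, hx⟩, hu⟩
    refine ⟨v a, ⟨⟨a, ha, rfl⟩, hx⟩, ?_⟩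
    rintro _ ⟨⟨b, hb, rfl⟩, hxb⟩
    rw [hu b ⟨hb, hxb⟩]

/-- Translates between pairs `(P, F)` and the condition on `F` alone that Cauchy-Binet produces. In
the reverse direction, the root of each tree provides the marked vertex that makes `φ` surjective.
-/
theorem isForestFor_and_matches_iff {G : SimpleGraph V} {v : Fin m ↪ V} {P : Setoid (Fin m)}
    {F : Finset (Sym2 V)} {U W : Finset (Fin m)} :
    IsForestFor G v P F ∧ Matches U W P ↔
      ((F : Set (Sym2 V)) ⊆ G.edgeSet ∧ (edgeGraph F).IsAcyclic ∧ UniquelyRootedAt v U F ∧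
        UniquelyRootedAt v W F) ∧ P = inducedPartition v F := by
  constructor
  · rintro ⟨h, hM⟩
    have hP := h.eq_inducedPartition
    have key : ∀ U : Finset (Fin m), (∀ a, ∃! u, u ∈ U ∧ P u a) → UniquelyRootedAt v U F := by
      intro U hM x
      obtain ⟨a, ha⟩ := h.exists_reachable x
      obtain ⟨u, ⟨hu, hua⟩, huu⟩ := hM a
      rw [hP] at hua huu
      refine ⟨u, ⟨hu, ha.trans hua.symm⟩, fun b hb => huu b ⟨hb.1, ?_⟩⟩
      exact hb.2.symm.trans ha
    exact ⟨⟨h.1, h.2.1, key U fun a => (hM a).1, key W fun a => (hM a).2⟩, hP⟩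
  · rintro ⟨⟨hE, hF, hU, hW⟩, rfl⟩
    have key : ∀ U : Finset (Fin m), UniquelyRootedAt v U F → ∀ a,
        ∃! u, u ∈ U ∧ inducedPartition v F u a := by
      intro U hU a
      obtain ⟨u, ⟨hu, hua⟩, huu⟩ := hU (v a)
      exact ⟨u, ⟨hu, hua.symm⟩, fun b hb => huu b ⟨hb.1, hb.2.symm⟩⟩
    refine ⟨⟨hE, hF, Equiv.ofBijective (Quotient.lift
      (fun a => (edgeGraph F).connectedComponentMk (v a))
      fun a b h => SimpleGraph.ConnectedComponent.sound h) ⟨?_, ?_⟩, fun a => rfl⟩,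
      fun a => ⟨key U hU a, key W hW a⟩⟩
    · rintro ⟨a⟩ ⟨b⟩ h
      exact Quotient.sound (SimpleGraph.ConnectedComponent.exact h)
    · intro C
      induction C using SimpleGraph.ConnectedComponent.ind with
      | _ x =>
        obtain ⟨a, ⟨-, ha⟩, -⟩ := hU x
        exact ⟨Quotient.mk _ a, SimpleGraph.ConnectedComponent.sound ha.symm⟩

/-- The second minor is a transfer determinant times the first, whose square is 1; orientations and
the enumeration `f` drop out. Unmarked vertices are never roots, so the transfer matrix is block
triangular with an identity block and only its marked block counts. -/
theorem det_incMatrix_mul_det_incMatrix [Fintype V] {ι : Type*} [Fintype ι] [DecidableEq ι]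
    {v : Fin m ↪ V} {p q : ι → Fin m} (hp : Function.Injective p) {U : Finset (Fin m)}
    (hU : ∀ a, a ∈ U ↔ a ∉ Set.range p) {F : Finset (Sym2 V)} (h : UniquelyRootedAt v U F)
    {f : ι ⊕ Unmarked v → Sym2 V} (hf : Function.Injective f) (himg : univ.image f = F) :
    (incMatrix (rowVertex v p) f).det * (incMatrix (rowVertex v q) f).det =
      ((transferMatrix (inducedPartition v F) U).submatrix q p).det := by
  have hρ := rowVertex_injective v hp
  have hr := (uniquelyRooted_rowVertex hU).2 h
  rw [incMatrix_eq_mul hρ hr (fun j => by rw [← himg]; exact mem_image_of_mem _ (mem_univ _))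
    (rowVertex v q), det_mul, mul_left_comm, det_incMatrix_mul_self hρ hf himg hr, mul_one]
  have hinr : ∀ x : Unmarked v, rowVertex v q (Sum.inr x) ∈ Set.range (rowVertex v p) :=
    fun x => ⟨Sum.inr x, rfl⟩
  have hinl : ∀ a, rowVertex v q (Sum.inl a) ∈ Set.range (rowVertex v p) ↔ q a ∉ U := by
    intro a
    rw [← not_iff_not, notMem_range_rowVertex hU, not_not]
    simp [rowVertex]
  trans (fromBlocks ((transferMatrix (inducedPartition v F) U).submatrix q p)
    (Matrix.of fun i (k : Unmarked v) =>
      if rowVertex v q (Sum.inl i) ∈ Set.range (rowVertex v p) then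
        if rowVertex v q (Sum.inl i) = rowVertex v p (Sum.inr k) then 1 else 0
      else if (edgeGraph F).Reachable (rowVertex v q (Sum.inl i)) (rowVertex v p (Sum.inr k))
        then -1 else 0) 0 1).det
  · congr 1
    ext (i | i) (k | k)
    · simp only [Matrix.of_apply, fromBlocks_apply₁₁, submatrix_apply, transferMatrix,
        inducedPartition_apply]
      by_cases hq : q i ∈ U
      · rw [if_neg fun h => (hinl i).1 h hq, if_pos hq]
        rfl
      · rw [if_pos ((hinl i).2 hq), if_neg hq]
        simp [rowVertex]
    · rfl
    · have : rowVertex v q (Sum.inr i) ≠ rowVertex v p (Sum.inl k) := fun h => i.2 ⟨_, h.symm⟩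
      simp only [Matrix.of_apply, fromBlocks_apply₂₁, Matrix.zero_apply]
      rw [if_pos (hinr i), if_neg this]
    · simp only [Matrix.of_apply, fromBlocks_apply₂₂, Matrix.one_apply]
      rw [if_pos (hinr i)]
      simp only [rowVertex, Sum.elim_inr, Subtype.ext_iff]
      congr
  · rw [det_fromBlocks_zero₂₁, det_one, mul_one]

noncomputable instance fintypeSetoid (m : ℕ) : Fintype (Setoid (Fin m)) := Fintype.ofFinite _

/-- The all minors matrix tree theorem, for minors that keep all unmarked vertices. The sign is
left as a determinant indexed by marked vertices. -/
theorem det_lap_submatrix [Fintype V] (G : SimpleGraph V) (v : Fin m ↪ V) {ι : Type*} [Fintype ι]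
    [DecidableEq ι] {p q : ι → Fin m} (hp : Function.Injective p) (hq : Function.Injective q)
    {U W : Finset (Fin m)} (hU : ∀ a, a ∈ U ↔ a ∉ Set.range p)
    (hW : ∀ a, a ∈ W ↔ a ∉ Set.range q) :
    ((lap G).submatrix (rowVertex v p) (rowVertex v q)).det =
      ∑ P : Setoid (Fin m), (if Matches U W P then
        ((transferMatrix P U).submatrix q p).det else 0) • forestGen G v P := by
  let n := ι ⊕ Unmarked v
  let ρ := rowVertex v p
  let σ := rowVertex v q
  have hex : ∀ S : Finset (Sym2 V), ∃ f : n → Sym2 V, S.card = Fintype.card n →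
      Function.Injective f ∧ univ.image f = S := by
    intro S
    by_cases hS : S.card = Fintype.card n
    · let e : n ≃ S := Fintype.equivOfCardEq (by rw [Fintype.card_coe, hS])
      refine ⟨fun i => e i, fun _ => ⟨fun a b h => e.injective (Subtype.ext h), ?_⟩⟩
      ext x
      simp only [mem_image, mem_univ, true_and]
      exact ⟨fun ⟨i, hi⟩ => hi ▸ (e i).2, fun hx => ⟨e.symm ⟨x, hx⟩, by simp⟩⟩
    -- An arbitrary value: Cauchy-Binet only uses sets of the right size.
    · exact ⟨fun i => s(ρ i, ρ i), fun h => absurd h hS⟩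
  choose f hf using hex
  let A : Matrix n (Sym2 V) (MvPolynomial (Sym2 V) ℤ) :=
    Matrix.of fun i e => edgeWeight G e * (inc e (ρ i) : ℤ)
  let B : Matrix (Sym2 V) n (MvPolynomial (Sym2 V) ℤ) := Matrix.of fun e j => (inc e (σ j) : ℤ)
  have hAB : (lap G).submatrix (rowVertex v p) (rowVertex v q) = A * B := by
    ext1 i j
    simp only [submatrix_apply, lap_eq_sum, Matrix.mul_apply, A, B, Matrix.of_apply, ρ, σ,
      mul_assoc]
  let Good : Finset (Sym2 V) → Prop := fun F => (F : Set (Sym2 V)) ⊆ G.edgeSet ∧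
    (edgeGraph F).IsAcyclic ∧ UniquelyRootedAt v U F ∧ UniquelyRootedAt v W F
  let t : Finset (Sym2 V) → MvPolynomial (Sym2 V) ℤ := fun F =>
    if Good F then Int.cast ((transferMatrix (inducedPartition v F) U).submatrix q p).det *
      ∏ e ∈ F, MvPolynomial.X e else 0
  have hl : ((lap G).submatrix (rowVertex v p) (rowVertex v q)).det = ∑ F, t F := by
    rw [hAB, det_mul_eq_sum_powersetCard A B f hf]
    trans ∑ F ∈ powersetCard (Fintype.card n) univ, t F
    · refine sum_congr rfl fun F hF => ?_
      obtain ⟨hinj, himg⟩ := hf F (mem_powersetCard.1 hF).2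
      have hA : (A.submatrix id (f F)).det =
          (∏ e ∈ F, edgeWeight G e) * ((incMatrix ρ (f F)).det : ℤ) := by
        have : A.submatrix id (f F) = Matrix.of fun i j => edgeWeight G (f F j) *
          (incMatrix ρ (f F)).map (Int.castRingHom (MvPolynomial (Sym2 V) ℤ)) i j := rfl
        rw [this, det_mul_row, prod_comp_enumeration hinj himg]
        congr 1
        exact ((Int.castRingHom (MvPolynomial (Sym2 V) ℤ)).map_det (incMatrix ρ (f F))).symm
      have hB : (B.submatrix (f F) id).det = ((incMatrix σ (f F)).det : ℤ) := by
        rw [← det_transpose]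
        exact ((Int.castRingHom (MvPolynomial (Sym2 V) ℤ)).map_det (incMatrix σ (f F))).symm
      rw [hA, hB, mul_assoc, ← Int.cast_mul]
      by_cases hE : (F : Set (Sym2 V)) ⊆ G.edgeSet
      · have hw : ∏ e ∈ F, edgeWeight G e = ∏ e ∈ F, MvPolynomial.X e :=
          prod_congr rfl fun e he => if_pos (hE he)
        simp only [t]
        split_ifs with hG
        · rw [det_incMatrix_mul_det_incMatrix hp hU hG.2.2.1 hinj himg, hw, mul_comm]
        · have : (incMatrix ρ (f F)).det * (incMatrix σ (f F)).det = 0 := by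
            by_contra hne
            have h1 := left_ne_zero_of_mul hne
            have h2 := right_ne_zero_of_mul hne
            exact hG ⟨hE, isAcyclic_of_det_ne_zero hinj himg h1,
              (uniquelyRooted_rowVertex hU).1
                (uniquelyRooted_of_det_ne_zero (rowVertex_injective v hp) hinj himg h1),
              (uniquelyRooted_rowVertex hW).1
                (uniquelyRooted_of_det_ne_zero (rowVertex_injective v hq) hinj himg h2)⟩
          rw [this, Int.cast_zero, mul_zero]
      · obtain ⟨e, he, heG⟩ := Set.not_subset.1 hE
        rw [prod_eq_zero (mem_coe.1 he) (if_neg heG), zero_mul]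
        exact (if_neg fun hG => hE hG.1).symm
    -- Good edge sets automatically have the right size, so the size restriction can be dropped.
    · refine sum_subset (subset_univ _) fun F _ hF => if_neg fun hG => hF ?_
      refine mem_powersetCard.2 ⟨subset_univ _, ?_⟩
      exact card_eq_of_uniquelyRooted hG.2.1
        (fun e he hd => G.not_isDiag_of_mem_edgeSet (hG.1 he) hd) (rowVertex_injective v hp)
        ((uniquelyRooted_rowVertex hU).2 hG.2.2.1)
  rw [hl]
  simp only [forestGen, smul_sum, sum_filter]
  rw [sum_comm]
  refine sum_congr rfl fun F _ => ?_
  rw [sum_eq_single (inducedPartition v F)]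
  · simp only [t]
    have := @isForestFor_and_matches_iff V m G v (inducedPartition v F) F U W
    simp only [and_true] at this
    by_cases hG : Good F
    · obtain ⟨h1, h2⟩ := this.2 hG
      rw [if_pos hG, if_pos h1, if_pos h2, zsmul_eq_mul]
    · rw [if_neg hG]
      split_ifs with h1 h2
      · exact absurd (this.1 ⟨h2, h1⟩) hG
      all_goals simp
  · intro P _ hP
    rw [if_neg fun h : IsForestFor G v P F => hP h.eq_inducedPartition, smul_zero]
  · simp

end AllMinors

/-! ### Signs of partitions and the formal sum of a block -/

section Combinatorics

open Finset
open scoped Classical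

variable {m : ℕ}

/-- Sending an element of `U` to its part is a bijection. Hence only `A` partitions, respectively
`B` partitions, occur in the expansions. -/
theorem Matches.numParts_eq {U W : Finset (Fin m)} {P : Setoid (Fin m)} (h : Matches U W P) :
    numParts P = U.card := by
  have : Function.Bijective fun u : U => (Quotient.mk P u.1) := by
    constructor
    · intro u u' huu
      exact Subtype.ext ((h u').1.unique ⟨u.2, Quotient.exact huu⟩ ⟨u'.2, P.refl _⟩)
    · rintro ⟨a⟩
      obtain ⟨u, ⟨hu, hua⟩, -⟩ := (h a).1
      exact ⟨⟨u, hu⟩, Quotient.sound hua⟩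
  rw [numParts, ← Nat.card_eq_of_bijective _ this]
  simp

theorem rel_of_not_rel {P : Setoid (Fin m)} (hP : numParts P = 2) {a b c : Fin m} (ha : ¬ P a c)
    (hb : ¬ P b c) : P a b := by
  by_contra hab
  have : Fintype (Quotient P) := Fintype.ofFinite _
  have h3 : ({Quotient.mk P a, Quotient.mk P b, Quotient.mk P c} : Finset (Quotient P)).card = 3 :=
    card_eq_three.2 ⟨_, _, _, fun h => hab (Quotient.exact h), fun h => ha (Quotient.exact h),
      fun h => hb (Quotient.exact h), rfl⟩
  have := card_le_univ ({Quotient.mk P a, Quotient.mk P b, Quotient.mk P c} : Finset (Quotient P))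
  rw [h3, ← Nat.card_eq_fintype_card] at this
  rw [numParts] at hP
  omega

/-- The partition whose only non-singleton part is `{a, b}`. -/
structure IsPair (P : Setoid (Fin m)) (a b : Fin m) : Prop where
  ne : a ≠ b
  rel : P a b
  eq_of_rel : ∀ x y, x ≠ y → P x y → s(x, y) = s(a, b)

theorem IsPair.symm {P : Setoid (Fin m)} {a b : Fin m} (h : IsPair P a b) : IsPair P b a :=
  ⟨h.ne.symm, P.symm h.rel, fun x y hxy hP => (h.eq_of_rel x y hxy hP).trans Sym2.eq_swap⟩

/-- Pigeonhole gives related `a` and `b`. Without `b` the quotient map is still onto and now between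
sets of equal size, so it is injective and there is no other coincidence. -/
theorem exists_isPair {d : ℕ} {P : Setoid (Fin (d + 2))} (hP : numParts P = d + 1) :
    ∃ a b, IsPair P a b := by
  have : Fintype (Quotient P) := Fintype.ofFinite _
  have hcard : Fintype.card (Quotient P) = d + 1 := by
    rw [← Nat.card_eq_fintype_card]; exact hP
  obtain ⟨a, b, hne, hab⟩ := Fintype.exists_ne_map_eq_of_card_lt (Quotient.mk P)
    (by rw [hcard, Fintype.card_fin]; omega)
  have hab' : P a b := Quotient.exact hab
  have hbij : Function.Bijective fun z : {z // z ≠ b} => Quotient.mk P z.1 := by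
    rw [Fintype.bijective_iff_surjective_and_card]
    constructor
    · rintro ⟨z⟩
      by_cases hz : z = b
      · exact ⟨⟨a, hne⟩, Quotient.sound (hz ▸ hab')⟩
      · exact ⟨⟨z, hz⟩, rfl⟩
    · rw [hcard, Fintype.card_subtype_compl]
      simp
  have hinj : ∀ x y, x ≠ b → y ≠ b → P x y → x = y := fun x y hx hy hxy =>
    congrArg Subtype.val (@hbij.1 ⟨x, hx⟩ ⟨y, hy⟩ (Quotient.sound hxy))
  refine ⟨a, b, hne, hab', fun x y hxy h => ?_⟩
  by_cases hx : x = b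
  · subst hx
    rw [hinj y a hxy.symm hne (P.symm (P.trans hab' h)), Sym2.eq_swap]
  · by_cases hy : y = b
    · subst hy
      rw [hinj x a hx hne (P.trans h (P.symm hab'))]
    · exact absurd (hinj x y hx hy h) hxy

theorem IsPair.existsUnique {P : Setoid (Fin m)} {a b : Fin m} (h : IsPair P a b) (z : Fin m) :
    ∃! u, u ∈ ({a}ᶜ : Finset (Fin m)) ∧ P u z := by
  simp only [mem_compl, mem_singleton]
  by_cases hz : z = a
  · subst hz
    refine ⟨b, ⟨h.ne.symm, P.symm h.rel⟩, fun u hu => ?_⟩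
    have := h.eq_of_rel u z hu.1 hu.2
    rw [Sym2.eq_swap] at this
    exact Sym2.congr_right.1 this
  · refine ⟨z, ⟨hz, P.refl z⟩, fun u hu => ?_⟩
    by_contra hne
    have := h.eq_of_rel u z hne hu.2
    rcases Sym2.eq_iff.1 this with h | h
    · exact hu.1 h.1
    · exact hz h.2

theorem IsPair.matches_iff {P : Setoid (Fin m)} {a b : Fin m} (h : IsPair P a b) (x y : Fin m) :
    Matches {x}ᶜ {y}ᶜ P ↔ (x = a ∨ x = b) ∧ (y = a ∨ y = b) := by
  constructor
  · intro hM
    have key : ∀ z, (∃! u, u ∈ ({z}ᶜ : Finset (Fin m)) ∧ P u z) → z = a ∨ z = b := by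
      rintro z ⟨u, ⟨hu, huz⟩, -⟩
      rcases Sym2.eq_iff.1 (h.eq_of_rel u z (by simpa using hu) huz) with h | h
      · exact Or.inr h.2
      · exact Or.inl h.2
    exact ⟨key x (hM x).1, key y (hM y).2⟩
  · have key : ∀ x, x = a ∨ x = b → ∀ z, ∃! u, u ∈ ({x}ᶜ : Finset (Fin m)) ∧ P u z := by
      rintro x (rfl | rfl)
      · exact h.existsUnique
      · exact h.symm.existsUnique
    exact fun hxy z => ⟨key x hxy.1 z, key y hxy.2 z⟩

theorem IsPair.minorCoeff_self {P : Setoid (Fin m)} {a b : Fin m} (h : IsPair P a b) :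
    minorCoeff {a}ᶜ {a}ᶜ P = 1 := by
  rw [minorCoeff, if_pos ((h.matches_iff a a).2 ⟨Or.inl rfl, Or.inl rfl⟩)]
  have : inversions ({a}ᶜ : Finset (Fin m)) {a}ᶜ P = 0 := by
    rw [inversions, card_eq_zero, filter_eq_empty_iff]
    rintro ⟨⟨u₁, u₂⟩, ⟨w₁, w₂⟩⟩ hq ⟨h1, h2, h3, h4⟩
    simp only [mem_product] at hq
    have e1 := (h.existsUnique w₁).unique ⟨hq.1.1, h2⟩ ⟨hq.2.1, P.refl _⟩
    have e2 := (h.existsUnique w₂).unique ⟨hq.1.2, h3⟩ ⟨hq.2.2, P.refl _⟩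
    simp only at h1 h4
    subst e1 e2
    exact absurd h1 h4.not_gt
  rw [this, add_zero, Even.neg_one_pow ⟨_, rfl⟩]

theorem IsPair.rel_iff {P : Setoid (Fin m)} {a b : Fin m} (h : IsPair P a b) {u w : Fin m}
    (hu : u ≠ a) (hw : w ≠ b) : P u w ↔ (u = w ∧ u ≠ b ∧ w ≠ a) ∨ (u = b ∧ w = a) := by
  constructor
  · intro huw
    by_cases he : u = w
    · subst he; exact Or.inl ⟨rfl, hw, hu⟩
    · rcases Sym2.eq_iff.1 (h.eq_of_rel u w he huw) with h | h
      · exact absurd h.1 hu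
      · exact Or.inr h
  · rintro (⟨rfl, -⟩ | ⟨rfl, rfl⟩)
    · exact P.refl _
    · exact P.symm h.rel

/-- The matching fixes everything except that it sends `b` to `a`, so its inversions pair `b` with
the elements strictly between `a` and `b`. One of the two intervals is empty. -/
theorem IsPair.inversions_eq {P : Setoid (Fin m)} {a b : Fin m} (h : IsPair P a b) :
    inversions ({a}ᶜ : Finset (Fin m)) {b}ᶜ P = (Ioo a b).card + (Ioo b a).card := by
  rw [inversions, ← card_image_of_injective (Ioo a b) (f := fun k => ((k, b), (k, a)))
    (fun x y h => by simpa using h),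
    ← card_image_of_injective (Ioo b a) (f := fun k => ((b, k), (a, k)))
    (fun x y h => by simpa using h), ← card_union_of_disjoint]
  · congr 1
    ext ⟨⟨u₁, u₂⟩, ⟨w₁, w₂⟩⟩
    simp only [mem_filter, mem_product, mem_compl, mem_singleton, mem_union, mem_image, mem_Ioo,
      Prod.mk.injEq]
    constructor
    · rintro ⟨⟨⟨h1, h2⟩, h3, h4⟩, h5, h6, h7, h8⟩
      rw [h.rel_iff h1 h3] at h6
      rw [h.rel_iff h2 h4] at h7
      rcases h6 with ⟨rfl, -, -⟩ | ⟨rfl, rfl⟩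
      · rcases h7 with ⟨rfl, -, -⟩ | ⟨rfl, rfl⟩
        · exact absurd h5 h8.not_gt
        · exact Or.inl ⟨u₁, ⟨h8, h5⟩, ⟨rfl, rfl⟩, rfl, rfl⟩
      · rcases h7 with ⟨rfl, -, -⟩ | ⟨rfl, rfl⟩
        · exact Or.inr ⟨u₂, ⟨h5, h8⟩, ⟨rfl, rfl⟩, rfl, rfl⟩
        · exact absurd h5 (lt_irrefl _)
    · rintro (⟨k, ⟨h1, h2⟩, ⟨rfl, rfl⟩, rfl, rfl⟩ | ⟨k, ⟨h1, h2⟩, ⟨rfl, rfl⟩, rfl, rfl⟩)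
      · exact ⟨⟨⟨h1.ne', h.ne.symm⟩, h2.ne, h.ne⟩, h2, P.refl _, P.symm h.rel, h1⟩
      · exact ⟨⟨⟨h.ne.symm, h2.ne⟩, h.ne, h1.ne'⟩, h1, P.symm h.rel, P.refl _, h2⟩
  · rw [disjoint_left]
    rintro _ h1 h2
    simp only [mem_image, mem_Ioo] at h1 h2
    obtain ⟨k, hk, rfl⟩ := h1
    obtain ⟨l, hl, -⟩ := h2
    exact absurd (hk.1.trans hk.2) (hl.1.trans hl.2).not_gt

theorem IsPair.minorCoeff_of_ne {P : Setoid (Fin m)} {a b : Fin m} (h : IsPair P a b) :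
    minorCoeff {a}ᶜ {b}ᶜ P = -1 := by
  rw [minorCoeff, if_pos ((h.matches_iff a b).2 ⟨Or.inl rfl, Or.inr rfl⟩), h.inversions_eq,
    Odd.neg_one_pow]
  -- Modulo 2 the two complement sums add up to `a + b`, and there are `|a - b| - 1` inversions, so
  -- the exponent is odd.
  have h1 : ∀ x : Fin m, ∑ y ∈ ({x}ᶜ : Finset (Fin m)), (y : ℕ) + x = ∑ y : Fin m, (y : ℕ) := by
    intro x
    rw [← sum_compl_add_sum {x}, sum_singleton]
  have ha := h1 a
  have hb := h1 b
  have hne : (a : ℕ) ≠ b := fun he => h.ne (Fin.ext he)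
  rw [Fin.card_Ioo, Fin.card_Ioo, Nat.odd_iff]
  omega

/-- The product form in `x` and `y` is what makes the double sum over `i` and `j` factor. -/
theorem IsPair.minorCoeff_eq {P : Setoid (Fin m)} {a b : Fin m} (h : IsPair P a b)
    (x y : Fin m) : minorCoeff {x}ᶜ {y}ᶜ P =
      ((if x = a then 1 else 0) - (if x = b then 1 else 0)) *
      ((if y = a then 1 else 0) - (if y = b then 1 else 0)) := by
  by_cases hM : (x = a ∨ x = b) ∧ (y = a ∨ y = b)
  · have hne := h.ne
    have hne' := h.ne.symm
    obtain ⟨rfl | rfl, rfl | rfl⟩ := hM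
    · simp [h.minorCoeff_self, hne]
    · simp [h.minorCoeff_of_ne, hne, hne']
    · simp [h.symm.minorCoeff_of_ne, hne, hne']
    · simp [h.symm.minorCoeff_self, hne']
  · rw [minorCoeff, if_neg fun h' => hM ((h.matches_iff x y).1 h')]
    have hM' : ¬ (x = a ∨ x = b) ∨ ¬ (y = a ∨ y = b) := not_and_or.1 hM
    rcases hM' with h1 | h1
    · rw [not_or] at h1; simp [h1.1, h1.2]
    · rw [not_or] at h1; simp [h1.1, h1.2]

theorem matches_pair {P : Setoid (Fin m)} (hP : numParts P = 2) {x r y c : Fin m}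
    (hxr : ¬ P x r) (hyc : ¬ P y c) : Matches {x, r} {y, c} P := by
  have key : ∀ x r, ¬ P x r → ∀ a, ∃! u, u ∈ ({x, r} : Finset (Fin m)) ∧ P u a := by
    intro x r hxr a
    simp only [mem_insert, mem_singleton]
    by_cases ha : P a r
    · refine ⟨r, ⟨Or.inr rfl, P.symm ha⟩, ?_⟩
      rintro u ⟨rfl | rfl, hu⟩
      · exact absurd (P.trans hu ha) hxr
      · rfl
    · refine ⟨x, ⟨Or.inl rfl, rel_of_not_rel hP hxr ha⟩, ?_⟩
      rintro u ⟨rfl | rfl, hu⟩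
      · rfl
      · exact absurd (P.symm hu) ha
  exact fun a => ⟨key x r hxr a, key y c hyc a⟩

theorem Matches.not_rel {P : Setoid (Fin m)} {x r y c : Fin m} (hxr : x ≠ r) (hyc : y ≠ c)
    (h : Matches {x, r} {y, c} P) : ¬ P x r ∧ ¬ P y c :=
  ⟨fun hP => hxr ((h r).1.unique ⟨by simp, hP⟩ ⟨by simp, P.refl _⟩),
    fun hP => hyc ((h c).2.unique ⟨by simp, hP⟩ ⟨by simp, P.refl _⟩)⟩

theorem inversions_pair_of_lt {P : Setoid (Fin m)} {x r y c : Fin m} (hxr : ¬ P x r)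
    (hxy : P x y) (hrc : P r c) (hlt : x < r) :
    inversions {x, r} {y, c} P = if c < y then 1 else 0 := by
  have hxc : ¬ P x c := fun h => hxr (P.trans h (P.symm hrc))
  have hry : ¬ P r y := fun h => hxr (P.trans hxy (P.symm h))
  have : ∀ q : (Fin m × Fin m) × (Fin m × Fin m),
      q ∈ ((({x, r} : Finset (Fin m)) ×ˢ {x, r}) ×ˢ (({y, c} : Finset (Fin m)) ×ˢ {y, c})) ∧
        (q.1.1 < q.1.2 ∧ P q.1.1 q.2.1 ∧ P q.1.2 q.2.2 ∧ q.2.2 < q.2.1) ↔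
      q = ((x, r), (y, c)) ∧ c < y := by
    rintro ⟨⟨u₁, u₂⟩, ⟨w₁, w₂⟩⟩
    simp only [mem_product, mem_insert, mem_singleton, Prod.mk.injEq]
    constructor
    · rintro ⟨⟨⟨rfl | rfl, rfl | rfl⟩, h3, h4⟩, h5, h6, h7, h8⟩
      · exact absurd h5 (lt_irrefl _)
      · rcases h3 with rfl | rfl
        · rcases h4 with rfl | rfl
          · exact absurd h7 hry
          · exact ⟨⟨⟨rfl, rfl⟩, rfl, rfl⟩, h8⟩
        · exact absurd h6 hxc
      · exact absurd hlt h5.not_gt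
      · exact absurd h5 (lt_irrefl _)
    · rintro ⟨⟨⟨rfl, rfl⟩, rfl, rfl⟩, h⟩
      exact ⟨⟨⟨Or.inl rfl, Or.inr rfl⟩, Or.inl rfl, Or.inr rfl⟩, hlt, hxy, hrc, h⟩
  rw [inversions]
  split_ifs with h
  · rw [card_eq_one]
    refine ⟨((x, r), (y, c)), ?_⟩
    ext q
    rw [mem_filter, this, mem_singleton]
    exact and_iff_left h
  · rw [card_eq_zero]
    ext q
    rw [mem_filter, this]
    simp [h]

theorem val_succAbove_cases {n : ℕ} (r : Fin (n + 1)) (i : Fin n) :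
    ((r.succAbove i : ℕ) = i ∧ r.succAbove i < r) ∨
      ((r.succAbove i : ℕ) = i + 1 ∧ r < r.succAbove i) := by
  rcases Fin.castSucc_lt_or_lt_succ r i with h | h
  · exact Or.inl ⟨by simp [Fin.succAbove_of_castSucc_lt _ _ h],
      by rwa [Fin.succAbove_of_castSucc_lt _ _ h]⟩
  · exact Or.inr ⟨by simp [Fin.succAbove_of_lt_succ _ _ h],
      by rwa [Fin.succAbove_of_lt_succ _ _ h]⟩

section

variable {d : ℕ} {P : Setoid (Fin (d + 2))} {r c : Fin (d + 2)} {i j : Fin (d + 1)}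

/-- `r.succAbove i` exceeds `i` by one exactly when it lies above `r`, and likewise for `c` and `j`.
Here the matching is inverted exactly when one of these two shifts occurs and the other does not, so
shifts and inversion cancel modulo 2. -/
theorem minorCoeff_pair_of_rel (hP : numParts P = 2) (hxr : ¬ P (r.succAbove i) r)
    (hxy : P (r.succAbove i) (c.succAbove j)) (hrc : P r c) :
    minorCoeff {r.succAbove i, r} {c.succAbove j, c} P =
      (-1) ^ ((i : ℕ) + j) * (-1) ^ ((r : ℕ) + c) := by
  have hyc : ¬ P (c.succAbove j) c := fun h => hxr (P.trans hxy (P.trans h (P.symm hrc)))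
  rw [minorCoeff, if_pos (matches_pair hP hxr hyc), sum_pair (Fin.succAbove_ne r i),
    sum_pair (Fin.succAbove_ne c j), ← pow_add, neg_one_pow_eq_pow_mod_two,
    neg_one_pow_eq_pow_mod_two (n := (i : ℕ) + j + (r + c))]
  congr 1
  have hsymm : ¬ P r (r.succAbove i) := fun h => hxr (P.symm h)
  rcases val_succAbove_cases r i with ⟨hi1, hi2⟩ | ⟨hi1, hi2⟩
  · rw [inversions_pair_of_lt hxr hxy hrc hi2]
    rcases val_succAbove_cases c j with ⟨hj1, hj2⟩ | ⟨hj1, hj2⟩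
    · rw [if_neg hj2.not_gt]; omega
    · rw [if_pos hj2]; omega
  · rw [pair_comm, pair_comm (c.succAbove j), inversions_pair_of_lt hsymm hrc hxy hi2]
    rcases val_succAbove_cases c j with ⟨hj1, hj2⟩ | ⟨hj1, hj2⟩
    · rw [if_pos hj2]; omega
    · rw [if_neg hj2.not_gt]; omega

/-- For the crossed matching an inversion occurs when both shifts or neither occur, which leaves one
extra sign. -/
theorem minorCoeff_pair_of_rel_swap (hP : numParts P = 2) (hxr : ¬ P (r.succAbove i) r)
    (hxc : P (r.succAbove i) c) (hry : P r (c.succAbove j)) :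
    minorCoeff {r.succAbove i, r} {c.succAbove j, c} P =
      -((-1) ^ ((i : ℕ) + j) * (-1) ^ ((r : ℕ) + c)) := by
  have hyc : ¬ P (c.succAbove j) c := fun h => hxr (P.trans hxc (P.symm (P.trans hry h)))
  rw [minorCoeff, if_pos (matches_pair hP hxr hyc), sum_pair (Fin.succAbove_ne r i),
    sum_pair (Fin.succAbove_ne c j), ← pow_add,
    show ∀ n, -((-1 : ℤ) ^ n) = (-1) ^ (n + 1) from fun n => by rw [pow_succ, mul_neg_one],
    neg_one_pow_eq_pow_mod_two, neg_one_pow_eq_pow_mod_two (n := (i : ℕ) + j + (r + c) + 1)]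
  congr 1
  have hsymm : ¬ P r (r.succAbove i) := fun h => hxr (P.symm h)
  rcases val_succAbove_cases r i with ⟨hi1, hi2⟩ | ⟨hi1, hi2⟩
  · rw [pair_comm (c.succAbove j), inversions_pair_of_lt hxr hxc hry hi2]
    rcases val_succAbove_cases c j with ⟨hj1, hj2⟩ | ⟨hj1, hj2⟩
    · rw [if_pos hj2]; omega
    · rw [if_neg hj2.not_gt]; omega
  · rw [pair_comm, inversions_pair_of_lt hsymm hry hxc hi2]
    rcases val_succAbove_cases c j with ⟨hj1, hj2⟩ | ⟨hj1, hj2⟩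
    · rw [if_neg hj2.not_gt]; omega
    · rw [if_pos hj2]; omega

end

/-- The coefficient of a two-part partition in the minor without the rows `x`, `r` and the columns
`y`, `c`, up to the signs of the removed positions. -/
noncomputable def pairSign (P : Setoid (Fin m)) (r c x y : Fin m) : ℤ :=
  (if P r c then 1 else -1) * ((if P x r then 0 else 1) * (if P y c then 0 else 1))

theorem minorCoeff_pair {d : ℕ} {P : Setoid (Fin (d + 2))} (hP : numParts P = 2)
    (r c : Fin (d + 2)) (i j : Fin (d + 1)) :
    minorCoeff {r.succAbove i, r} {c.succAbove j, c} P =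
      (-1) ^ ((i : ℕ) + j) * (-1) ^ ((r : ℕ) + c) *
        pairSign P r c (r.succAbove i) (c.succAbove j) := by
  rw [pairSign]
  by_cases hM : Matches {r.succAbove i, r} {c.succAbove j, c} P
  · obtain ⟨hxr, hyc⟩ := hM.not_rel (Fin.succAbove_ne r i) (Fin.succAbove_ne c j)
    rw [if_neg hxr, if_neg hyc]
    by_cases hrc : P r c
    · have hyr : ¬ P (c.succAbove j) r := fun h => hyc (P.trans h hrc)
      rw [minorCoeff_pair_of_rel hP hxr (rel_of_not_rel hP hxr hyr) hrc, if_pos hrc]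
      ring
    · have hcr : ¬ P c r := fun h => hrc (P.symm h)
      rw [minorCoeff_pair_of_rel_swap hP hxr (rel_of_not_rel hP hxr hcr)
        (rel_of_not_rel hP hrc hyc), if_neg hrc]
      ring
  · rw [minorCoeff, if_neg hM]
    by_cases hxr : P (r.succAbove i) r
    · simp [hxr]
    · by_cases hyc : P (c.succAbove j) c
      · simp [hyc]
      · exact absurd (matches_pair hP hxr hyc) hM

theorem IsPair.forbidden_iff {P Q : Setoid (Fin m)} {a b : Fin m} (h : IsPair P a b) :
    Forbidden P Q ↔ Q a b := by
  constructor
  · rintro ⟨x, y, hxy, hP, hQ⟩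
    rcases Sym2.eq_iff.1 (h.eq_of_rel x y hxy hP) with ⟨rfl, rfl⟩ | ⟨rfl, rfl⟩
    · exact hQ
    · exact Q.symm hQ
  · exact fun hQ => ⟨a, b, h.ne, h.rel, hQ⟩

theorem not_forbidden_iff_permissible {d : ℕ} (c : Fin (d + 2)) (A : APart (d + 2))
    (B : BPart (d + 2)) : ¬ Forbidden A.1 B.1 ↔ ∃ j, Permissible c j A B := by
  constructor
  · obtain ⟨a, b, h⟩ := exists_isPair A.2
    rw [h.forbidden_iff]
    intro hab
    -- As `B` separates `a` and `b`, exactly one of them is with `c`; the other one is `j`.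
    by_cases hca : B.1 c a
    · exact ⟨b, a, h.ne, h.symm.rel, h.symm.eq_of_rel,
        fun hbc => hab (B.1.symm (B.1.trans hbc hca)), hca⟩
    · exact ⟨a, b, h.ne.symm, h.rel, h.eq_of_rel, fun hac => hca (B.1.symm hac),
        rel_of_not_rel B.2 hca fun hba => hab (B.1.symm hba)⟩
  · rintro ⟨j, l, hlj, hA, heq, hjc, hcl⟩
    rw [IsPair.forbidden_iff ⟨hlj.symm, hA, heq⟩]
    exact fun hjl => hjc (B.1.trans hjl (B.1.symm hcl))

/-- Since `f r = 0` and `g c = 0`, the sums over `i` and `j` extend to all marked vertices and give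
`f a - f b` and `g a - g b`. These vanish if `B` joins `a` and `b`. Otherwise both are `±1`, and
they agree exactly when `B` joins `r` and `c`, which the prefactor of `pairSign` compensates. -/
theorem sum_minorCoeff_mul_pairSign {d : ℕ} (A : APart (d + 2)) (B : BPart (d + 2))
    (r c : Fin (d + 2)) :
    ∑ j : Fin (d + 1), ∑ i : Fin (d + 1), minorCoeff {r.succAbove i}ᶜ {c.succAbove j}ᶜ A.1 *
      pairSign B.1 r c (r.succAbove i) (c.succAbove j) = if Forbidden A.1 B.1 then 0 else 1 := by
  obtain ⟨a, b, h⟩ := exists_isPair A.2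
  let f : Fin (d + 2) → ℤ := fun x => if B.1 x r then 0 else 1
  let g : Fin (d + 2) → ℤ := fun y => if B.1 y c then 0 else 1
  let δ : Fin (d + 2) → ℤ := fun x => (if x = a then 1 else 0) - (if x = b then 1 else 0)
  have hfr : f r = 0 := if_pos (B.1.refl _)
  have hgc : g c = 0 := if_pos (B.1.refl _)
  have hf : ∑ i : Fin (d + 1), δ (r.succAbove i) * f (r.succAbove i) = f a - f b := by
    have := Fin.sum_univ_succAbove (fun x => δ x * f x) r
    rw [hfr, mul_zero, zero_add] at this
    rw [← this]
    simp [δ, sub_mul, sum_sub_distrib]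
  have hg : ∑ j : Fin (d + 1), δ (c.succAbove j) * g (c.succAbove j) = g a - g b := by
    have := Fin.sum_univ_succAbove (fun x => δ x * g x) c
    rw [hgc, mul_zero, zero_add] at this
    rw [← this]
    simp [δ, sub_mul, sum_sub_distrib]
  trans (if B.1 r c then 1 else -1) * ((f a - f b) * (g a - g b))
  · rw [← hf, ← hg, sum_mul_sum, sum_comm, mul_sum]
    refine sum_congr rfl fun i _ => ?_
    rw [mul_sum]
    refine sum_congr rfl fun j _ => ?_
    rw [h.minorCoeff_eq, pairSign]
    simp only [δ, f, g]
    ring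
  · rw [if_congr h.forbidden_iff rfl rfl]
    have key : ∀ {x y z}, B.1 x y → (B.1 x z ↔ B.1 y z) := fun {x y z} hxy =>
      ⟨fun h => B.1.trans (B.1.symm hxy) h, fun h => B.1.trans hxy h⟩
    by_cases hab : B.1 a b
    · have h1 : f a = f b := if_congr (key hab) rfl rfl
      rw [h1, if_pos hab, sub_self, zero_mul, mul_zero]
    · rw [if_neg hab]
      have h2 : ∀ z, B.1 a z ↔ ¬ B.1 b z := fun z =>
        ⟨fun h1 h2 => hab (B.1.trans h1 (B.1.symm h2)), fun h2 => by
          by_contra h1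
          exact hab (rel_of_not_rel B.2 h1 h2)⟩
      have h3 : B.1 r c ↔ (B.1 b r ↔ B.1 b c) := by
        constructor
        · exact fun h => ⟨fun h' => B.1.trans h' h, fun h' => B.1.trans h' (B.1.symm h)⟩
        · intro h
          by_cases hbr : B.1 b r
          · exact B.1.trans (B.1.symm hbr) (h.1 hbr)
          · exact B.1.trans (B.1.symm ((h2 r).2 hbr)) ((h2 c).2 fun h' => hbr (h.2 h'))
      simp only [f, g, h2, h3]
      by_cases hr : B.1 b r <;> by_cases hc : B.1 b c <;> simp [hr, hc]

/-- The position signs of the cofactor and of `det M` are those of the `B` coefficient, so they all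
cancel. -/
theorem rhs_eq {d : ℕ} (r c : Fin (d + 2)) (j : Fin (d + 1)) :
    rhs r c j = ∑ A : APart (d + 2), ∑ B : BPart (d + 2),
      (∑ i : Fin (d + 1), minorCoeff {r.succAbove i}ᶜ {c.succAbove j}ᶜ A.1 *
        pairSign B.1 r c (r.succAbove i) (c.succAbove j)) • monom A B := by
  have hone : ∀ n : ℕ, (-1 : ℤ) ^ n * (-1) ^ n = 1 := fun n => by
    rw [← pow_add, Even.neg_one_pow ⟨_, rfl⟩]
  simp only [rhs, smul_sum, sum_smul]
  rw [sum_comm]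
  refine sum_congr rfl fun A _ => ?_
  rw [sum_comm]
  refine sum_congr rfl fun B _ => sum_congr rfl fun i _ => ?_
  rw [minorCoeff_pair B.2, smul_smul, smul_smul]
  congr 1
  linear_combination (minorCoeff {r.succAbove i}ᶜ {c.succAbove j}ᶜ A.1 *
    pairSign B.1 r c (r.succAbove i) (c.succAbove j)) *
    ((-1 : ℤ) ^ ((i : ℕ) + j) * (-1) ^ ((i : ℕ) + j) * hone ((r : ℕ) + c) + hone ((i : ℕ) + j))

theorem sum_rhs {d : ℕ} (r c : Fin (d + 2)) :
    ∑ j : Fin (d + 1), rhs r c j = sumNonForbidden (d + 2) := by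
  simp only [rhs_eq, sumNonForbidden]
  rw [sum_comm]
  refine sum_congr rfl fun A _ => ?_
  rw [sum_comm]
  refine sum_congr rfl fun B _ => ?_
  rw [← sum_smul, sum_minorCoeff_mul_pairSign, ite_smul, zero_smul, one_smul]

end Combinatorics

/-! ### Forest expansions of the four determinants -/

section Expansions

open Matrix Finset
open scoped Classical

/-- With the unit rows inserted, the matrix is a product of two exchanges on the disjoint parts of
`r` and `x`, each of determinant 1. -/
theorem det_updateRow_transferMatrix_pair {m : ℕ} {P : Setoid (Fin m)} {x r y c : Fin m}
    (hxr : ¬ P x r) (hxy : P x y) (hrc : P r c) :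
    (((transferMatrix P {x, r}).updateRow y (Pi.single x 1)).updateRow c (Pi.single r 1)).det
      = 1 := by
  have hrx : ¬ P r x := fun h => hxr (P.symm h)
  have hry : r ≠ y := by rintro rfl; exact hxr hxy
  have hxc : x ≠ c := by rintro rfl; exact hxr (P.symm hrc)
  have hrx' : r ≠ x := by rintro rfl; exact hxr (P.refl _)
  have hcy : c ≠ y := by rintro rfl; exact hxr (P.trans hxy (P.symm hrc))
  have hE : ∀ k, P r k → ∀ b, exchangeMatrix P y x k b = if k = b then 1 else 0 := by
    intro k hk b
    have h1 : k ≠ y := by rintro rfl; exact hxr (P.trans hxy (P.symm hk))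
    have h2 : k ≠ x := by rintro rfl; exact hrx hk
    simp [exchangeMatrix, h1, h2]
  have hmul : ((transferMatrix P {x, r}).updateRow y (Pi.single x 1)).updateRow c
      (Pi.single r 1) = exchangeMatrix P c r * exchangeMatrix P y x := by
    ext a b
    rw [Matrix.mul_apply]
    by_cases hac : a = c
    · subst hac
      rw [updateRow_self, sum_eq_single r]
      · rw [hE r (P.refl _)]
        simp [exchangeMatrix, Pi.single_apply, eq_comm]
      · intro k _ hk
        simp [exchangeMatrix, hk]
      · simp
    · rw [updateRow_ne hac]
      by_cases har : a = r
      · subst har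
        rw [updateRow_ne hry, sum_eq_single b]
        · by_cases hab : P a b
          · rw [hE b hab]
            simp [exchangeMatrix, transferMatrix, hac]
          · simp [exchangeMatrix, transferMatrix, hac, hab]
        · intro k _ hk
          by_cases hak : P a k
          · rw [hE k hak, if_neg hk, mul_zero]
          · simp [exchangeMatrix, hac, hak]
        · simp
      · rw [sum_eq_single a]
        · by_cases hay : a = y
          · subst hay
            rw [updateRow_self]
            simp [exchangeMatrix, hac, har, Pi.single_apply]
          · rw [updateRow_ne hay]
            by_cases hax : a = x
            · subst hax
              simp [exchangeMatrix, transferMatrix, hac, har, hay]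
            · simp [exchangeMatrix, transferMatrix, hac, har, hay, hax]
        · intro k _ hk
          simp [exchangeMatrix, hac, har, Ne.symm hk]
        · simp
  rw [hmul, det_mul, det_exchangeMatrix P c r hrc, det_exchangeMatrix P y x hxy, mul_one]

/-- Interchanging rows `c` and `y` reduces to the straight matching with `x` and `r` in exchanged
roles. -/
theorem det_updateRow_transferMatrix_pair_swap {m : ℕ} {P : Setoid (Fin m)} {x r y c : Fin m}
    (hxr : ¬ P x r) (hxc : P x c) (hry : P r y) :
    (((transferMatrix P {x, r}).updateRow y (Pi.single x 1)).updateRow c (Pi.single r 1)).det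
      = -1 := by
  have hcy : c ≠ y := by rintro rfl; exact hxr (P.trans hxc (P.symm hry))
  have h := det_updateRow_transferMatrix_pair (x := r) (r := x) (fun h => hxr (P.symm h)) hry hxc
  rw [pair_comm] at h
  have hs : ((transferMatrix P {x, r}).updateRow y (Pi.single x 1)).updateRow c
      (Pi.single r 1) = (((transferMatrix P {x, r}).updateRow y (Pi.single r 1)).updateRow c
      (Pi.single x 1)).submatrix (Equiv.swap c y) id := by
    ext a b
    rw [submatrix_apply]
    by_cases hac : a = c
    · subst hac
      rw [updateRow_self, Equiv.swap_apply_left, updateRow_ne hcy.symm, updateRow_self]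
      rfl
    · rw [updateRow_ne hac]
      by_cases hay : a = y
      · subst hay
        rw [updateRow_self, Equiv.swap_apply_right, updateRow_self]
        rfl
      · rw [updateRow_ne hay, Equiv.swap_apply_of_ne_of_ne hac hay, updateRow_ne hac,
          updateRow_ne hay]
        rfl
  rw [hs, det_permute, Equiv.Perm.sign_swap hcy, h]
  simp

theorem det_transferMatrix_pair {d : ℕ} {P : Setoid (Fin (d + 2))} (hP : numParts P = 2)
    {r c : Fin (d + 2)} {i j : Fin (d + 1)}
    (hM : Matches {r.succAbove i, r} {c.succAbove j, c} P) :
    ((transferMatrix P {r.succAbove i, r}).submatrix (c.succAbove ∘ j.succAbove)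
      (r.succAbove ∘ i.succAbove)).det = minorCoeff {r.succAbove i, r} {c.succAbove j, c} P := by
  obtain ⟨hxr, hyc⟩ := hM.not_rel (Fin.succAbove_ne r i) (Fin.succAbove_ne c j)
  rw [det_submatrix_succAbove_succAbove, minorCoeff_pair hP, pairSign, if_neg hxr, if_neg hyc,
    add_comm (j : ℕ), add_comm (c : ℕ)]
  by_cases hrc : P r c
  · have hyr : ¬ P (c.succAbove j) r := fun h => hyc (P.trans h hrc)
    rw [det_updateRow_transferMatrix_pair hxr (rel_of_not_rel hP hxr hyr) hrc, if_pos hrc]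
    ring
  · have hcr : ¬ P c r := fun h => hrc (P.symm h)
    rw [det_updateRow_transferMatrix_pair_swap hxr (rel_of_not_rel hP hxr hcr)
        (rel_of_not_rel hP hrc hyc), if_neg hrc]
    ring

theorem det_transferMatrix_top {k : ℕ} (r c : Fin (k + 1)) :
    ((transferMatrix (⊤ : Setoid (Fin (k + 1))) {r}).submatrix c.succAbove r.succAbove).det =
      (-1) ^ ((r : ℕ) + c) := by
  have : (transferMatrix (⊤ : Setoid (Fin (k + 1))) {r}).updateRow c (Pi.single r 1) =
      exchangeMatrix ⊤ c r := by
    ext a b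
    by_cases hac : a = c
    · subst hac
      simp [exchangeMatrix, Pi.single_apply]
    · simp [exchangeMatrix, transferMatrix, hac]
  rw [det_submatrix_succAbove, this, det_exchangeMatrix _ _ _ trivial, mul_one, add_comm]

theorem matches_singleton_iff {m : ℕ} {P : Setoid (Fin m)} {r c : Fin m} :
    Matches {r} {c} P ↔ P = ⊤ := by
  constructor
  · intro h
    have key : ∀ a, P r a := fun a => by
      obtain ⟨u, ⟨hu, hua⟩, -⟩ := (h a).1
      rwa [mem_singleton.1 hu] at hua
    rw [Setoid.eq_top_iff]
    exact fun a b => P.trans (P.symm (key a)) (key b)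
  · rintro rfl a
    exact ⟨⟨r, ⟨mem_singleton_self _, trivial⟩, fun u hu => mem_singleton.1 hu.1⟩,
      ⟨c, ⟨mem_singleton_self _, trivial⟩, fun u hu => mem_singleton.1 hu.1⟩⟩

theorem matches_univ_iff {m : ℕ} {P : Setoid (Fin m)} :
    Matches univ univ P ↔ P = ⊥ := by
  constructor
  · intro h
    ext a b
    exact ⟨fun hab => (h b).1.unique ⟨mem_univ _, hab⟩ ⟨mem_univ _, P.refl _⟩,
      fun hab => by rw [show a = b from hab]⟩
  · rintro rfl a
    exact ⟨⟨a, ⟨mem_univ _, rfl⟩, fun u hu => hu.2⟩, ⟨a, ⟨mem_univ _, rfl⟩, fun u hu => hu.2⟩⟩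

variable {V : Type*} [Fintype V] {d : ℕ}

theorem det_lapRemove (G : SimpleGraph V) (v : Fin (d + 1) ↪ V) (r c : Fin (d + 1)) :
    (lapRemove G v r c).det = (-1) ^ ((r : ℕ) + c) * forestGen G v ⊤ := by
  have := det_lap_submatrix G v (p := r.succAbove) (q := c.succAbove)
    Fin.succAbove_right_injective Fin.succAbove_right_injective (U := {r}) (W := {c})
    (by simp [Fin.range_succAbove]) (by simp [Fin.range_succAbove])
  refine Eq.trans ?_ (this.trans ?_)
  · unfold lapRemove rowVertex; congr!
  · rw [sum_eq_single ⊤]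
    · rw [if_pos (matches_singleton_iff.2 rfl), det_transferMatrix_top, zsmul_eq_mul]
      push_cast
      rfl
    · intro P _ hP
      rw [if_neg fun h => hP (matches_singleton_iff.1 h), zero_smul]
    · simp

theorem detCore_lapRemove (G : SimpleGraph V) (v : Fin (d + 1) ↪ V) (r c : Fin (d + 1)) :
    detCore (lapRemove G v r c) = forestGen G v ⊥ := by
  have := det_lap_submatrix G v (p := (Fin.elim0 : Fin 0 → Fin (d + 1)))
    (q := (Fin.elim0 : Fin 0 → Fin (d + 1)))
    (fun a => a.elim0) (fun a => a.elim0) (U := univ) (W := univ)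
    (by simp) (by simp)
  refine Eq.trans ?_ (this.trans ?_)
  · rw [← det_submatrix_equiv_self (Equiv.emptySum (Fin 0) (Unmarked v)).symm]
    unfold detCore
    congr! 1
  · rw [sum_eq_single ⊥]
    · rw [if_pos (matches_univ_iff.2 rfl), det_fin_zero, one_smul]
    · intro P _ hP
      rw [if_neg fun h => hP (matches_univ_iff.1 h), zero_smul]
    · simp

/-- A sum over set partitions weighted by minor coefficients, restricted to the partitions with
the right number of parts. -/
theorem sum_matches_eq_sum_minorCoeff {m k : ℕ} {U W : Finset (Fin m)} (hU : U.card = k)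
    {M : Type*} [AddCommGroup M] {D : Setoid (Fin m) → ℤ}
    (hD : ∀ P, numParts P = k → Matches U W P → D P = minorCoeff U W P) (g : Setoid (Fin m) → M)
    [Fintype {P : Setoid (Fin m) // numParts P = k}] :
    ∑ P : Setoid (Fin m), (if Matches U W P then D P else 0) • g P =
      ∑ A : {P : Setoid (Fin m) // numParts P = k}, minorCoeff U W A.1 • g A.1 := by
  rw [← sum_subtype (univ.filter fun P => numParts P = k) (by simp)
    (fun P => minorCoeff U W P • g P), sum_filter]
  refine sum_congr rfl fun P _ => ?_
  by_cases hM : Matches U W P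
  · have hP : numParts P = k := hM.numParts_eq.trans hU
    rw [if_pos hM, if_pos hP, hD P hP hM]
  · rw [if_neg hM, minorCoeff, if_neg hM]
    simp

theorem detKeep_lapRemove (G : SimpleGraph V) (v : Fin (d + 2) ↪ V) (r c : Fin (d + 2))
    (i j : Fin (d + 1)) : detKeep (lapRemove G v r c) i j =
      ∑ A : APart (d + 2), minorCoeff {r.succAbove i}ᶜ {c.succAbove j}ᶜ A.1 •
        forestGen G v A.1 := by
  have := det_lap_submatrix G v (p := fun _ : Unit => r.succAbove i)
    (q := fun _ : Unit => c.succAbove j)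
    (fun _ _ _ => rfl) (fun _ _ _ => rfl) (U := {r.succAbove i}ᶜ) (W := {c.succAbove j}ᶜ)
    (by simp) (by simp)
  refine Eq.trans ?_ (this.trans (sum_matches_eq_sum_minorCoeff ?_ ?_ _))
  · unfold detKeep lapRemove rowVertex
    rw [submatrix_submatrix]
    congr! 2
    · ext (x | x) <;> rfl
    · ext (x | x) <;> rfl
  · simp [card_compl]
  · intro P hP hM
    obtain ⟨a, b, h⟩ := exists_isPair hP
    rw [h.minorCoeff_eq]
    obtain ⟨hx, hy⟩ := (h.matches_iff _ _).1 hM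
    have hne := h.ne
    have hne' := h.ne.symm
    have hab := h.rel
    have hba := P.symm h.rel
    -- The minor keeps one marked row and column, so the sign is a single transfer entry: 1 if the
    -- two vertices agree, -1 if they are the two members of the pair.
    rw [det_unique]
    simp only [submatrix_apply, transferMatrix, Matrix.of_apply, mem_compl, mem_singleton]
    obtain hx | hx := hx <;> obtain hy | hy := hy <;> rw [hx, hy] <;> simp [hne, hne', hab, hba]

theorem detDrop_lapRemove (G : SimpleGraph V) (v : Fin (d + 2) ↪ V) (r c : Fin (d + 2))
    (i j : Fin (d + 1)) : detDrop (lapRemove G v r c) i j =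
      ∑ B : BPart (d + 2), minorCoeff {r.succAbove i, r} {c.succAbove j, c} B.1 •
        forestGen G v B.1 := by
  have hrange : ∀ (r : Fin (d + 2)) (i : Fin (d + 1)) (a : Fin (d + 2)),
      a ∈ ({r.succAbove i, r} : Finset _) ↔ a ∉ Set.range (r.succAbove ∘ i.succAbove) := by
    intro r i a
    rw [Set.range_comp, Fin.range_succAbove, mem_insert, mem_singleton]
    rcases Fin.eq_self_or_eq_succAbove r a with rfl | ⟨k, rfl⟩
    · simp [Fin.succAbove_ne]
    · simp [Fin.succAbove_ne]
  have := det_lap_submatrix G v (p := r.succAbove ∘ i.succAbove) (q := c.succAbove ∘ j.succAbove)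
    (Fin.succAbove_right_injective.comp Fin.succAbove_right_injective)
    (Fin.succAbove_right_injective.comp Fin.succAbove_right_injective)
    (hrange r i) (hrange c j)
  refine Eq.trans ?_ (this.trans (sum_matches_eq_sum_minorCoeff ?_
    (fun P hP hM => det_transferMatrix_pair hP hM) _))
  · unfold detDrop lapRemove rowVertex
    rw [submatrix_submatrix]
    congr! 2
    · ext (x | x) <;> rfl
    · ext (x | x) <;> rfl
  · exact card_pair (Fin.succAbove_ne r i)

theorem arisesFromColumnExpansion (G : SimpleGraph V) (v : Fin (d + 2) ↪ V) (r c : Fin (d + 2))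
    (j : Fin (d + 1)) : ArisesFromColumnExpansion G v r c j where
  expansion := column_expansion _ j
  tree := by rw [← det_lapRemove G v r c]
  core := detCore_lapRemove G v r c
  keep i := detKeep_lapRemove G v r c i j
  drop i := detDrop_lapRemove G v r c i j

end Expansions

/-! ### From edges in the forest to edges outside it -/

section Duality

open Finset
open scoped Classical

variable {V : Type*} [Fintype V] {m d : ℕ}

/-- Evaluation of a formal sum of pairs `A B` at the generating polynomials of spanning forests. -/
noncomputable def evalGen (G : SimpleGraph V) (v : Fin m ↪ V) :
    VSpace m →ₗ[ℤ] MvPolynomial (Sym2 V) ℤ :=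
  Finsupp.linearCombination ℤ fun p => forestGen G v p.1.1 * forestGen G v p.2.1

/-- This is the column expansion identity with its determinants expanded; the sign of `det M` is
moved to the right, being its own inverse. -/
theorem forestGen_top_mul_forestGen_bot (G : SimpleGraph V) (v : Fin (d + 2) ↪ V)
    (r c : Fin (d + 2)) (j : Fin (d + 1)) :
    forestGen G v ⊤ * forestGen G v ⊥ = evalGen G v (rhs r c j) := by
  have h := arisesFromColumnExpansion G v r c j
  have hone : ((-1 : MvPolynomial (Sym2 V) ℤ) ^ ((r : ℕ) + c)) * (-1) ^ ((r : ℕ) + c) = 1 := by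
    rw [← pow_add, Even.neg_one_pow ⟨_, rfl⟩]
  have he := h.expansion
  rw [h.core, h.tree] at he
  have : forestGen G v ⊤ * forestGen G v ⊥ = (-1) ^ ((r : ℕ) + c) *
      ((-1) ^ ((r : ℕ) + c) * forestGen G v ⊤ * forestGen G v ⊥) := by
    rw [← mul_assoc, ← mul_assoc, hone, one_mul]
  rw [this, he]
  simp only [rhs, map_smul, map_sum, evalGen, monom, Finsupp.linearCombination_single, one_smul,
    h.keep, h.drop]
  rw [zsmul_eq_mul]
  push_cast
  congr 1
  refine sum_congr rfl fun i _ => ?_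
  rw [zsmul_eq_mul]
  push_cast
  congr 1
  rw [mul_comm, sum_mul_sum]
  refine sum_congr rfl fun A _ => sum_congr rfl fun B _ => ?_
  rw [smul_mul_smul_comm]

/-- The substitution of the inverses of the edge variables. -/
noncomputable def invertVars (V : Type*) :
    MvPolynomial (Sym2 V) ℤ →ₐ[ℤ] FractionRing (MvPolynomial (Sym2 V) ℤ) :=
  MvPolynomial.aeval fun e => (algebraMap (MvPolynomial (Sym2 V) ℤ) _ (MvPolynomial.X e))⁻¹

/-- The product of all edge variables. -/
noncomputable def edgeProd (G : SimpleGraph V) : MvPolynomial (Sym2 V) ℤ :=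
  ∏ e : Sym2 V with e ∈ G.edgeSet, MvPolynomial.X e

/-- Term by term, the product outside `F` is the product over all edges divided by the product over
`F`. -/
theorem algebraMap_forestPoly (G : SimpleGraph V) (v : Fin m ↪ V) (P : Setoid (Fin m)) :
    algebraMap _ (FractionRing (MvPolynomial (Sym2 V) ℤ)) (forestPoly G v P) =
      algebraMap _ _ (edgeProd G) * invertVars V (forestGen G v P) := by
  have hX : ∀ e : Sym2 V, algebraMap (MvPolynomial (Sym2 V) ℤ)
      (FractionRing (MvPolynomial (Sym2 V) ℤ)) (MvPolynomial.X e) ≠ 0 := fun e =>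
    (map_ne_zero_iff _ (IsFractionRing.injective _ _)).2 (MvPolynomial.X_ne_zero e)
  rw [forestPoly, forestGen, map_sum, map_sum, mul_sum]
  refine sum_congr rfl fun F hF => ?_
  have hE : (F : Set (Sym2 V)) ⊆ G.edgeSet := (mem_filter.1 hF).2.1
  have hsplit : edgeProd G = (∏ e : Sym2 V with e ∈ G.edgeSet ∧ e ∉ F, MvPolynomial.X e) *
      ∏ e ∈ F, MvPolynomial.X e := by
    rw [edgeProd, ← prod_union]
    · refine prod_congr ?_ fun _ _ => rfl
      ext e
      simp only [mem_filter, mem_univ, true_and, mem_union]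
      by_cases he : e ∈ F
      · simp [he, hE (mem_coe.2 he)]
      · simp [he]
    · rw [disjoint_left]
      intro e he
      exact (mem_filter.1 he).2.2
  rw [hsplit, map_mul, map_prod (invertVars V), map_prod (algebraMap _ _) _ F, mul_assoc,
    ← prod_mul_distrib, prod_eq_one (s := F), mul_one]
  intro e _
  rw [invertVars, MvPolynomial.aeval_X, mul_inv_cancel₀ (hX e)]

/-- Every monomial has two factors, so the same `edgeProd G ^ 2` comes out of all terms and duality
is linear on `VSpace m`. -/
theorem algebraMap_evalAB (G : SimpleGraph V) (v : Fin m ↪ V) (x : VSpace m) :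
    algebraMap _ (FractionRing (MvPolynomial (Sym2 V) ℤ)) (evalAB G v x) =
      algebraMap _ _ (edgeProd G) ^ 2 * invertVars V (evalGen G v x) := by
  induction x using Finsupp.induction_linear with
  | zero => simp
  | add x y hx hy => rw [map_add, map_add, map_add, map_add, hx, hy, mul_add]
  | single p n =>
    rw [evalAB, evalGen, Finsupp.linearCombination_single, Finsupp.linearCombination_single,
      map_zsmul, map_zsmul, map_mul, map_mul, algebraMap_forestPoly, algebraMap_forestPoly,
      mul_smul_comm]
    congr 1
    ring

theorem forestPoly_top_mul_forestPoly_bot (G : SimpleGraph V) (v : Fin (d + 2) ↪ V)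
    (r c : Fin (d + 2)) (j : Fin (d + 1)) :
    forestPoly G v ⊤ * forestPoly G v ⊥ = evalAB G v (rhs r c j) := by
  apply IsFractionRing.injective (MvPolynomial (Sym2 V) ℤ)
    (FractionRing (MvPolynomial (Sym2 V) ℤ))
  rw [algebraMap_evalAB, ← forestGen_top_mul_forestGen_bot, map_mul, map_mul,
    algebraMap_forestPoly, algebraMap_forestPoly]
  ring

end Duality

end ForestId


theorem theorem3p2 (d : ℕ) :
    -- every block, for a fixed removed column `c` (and any removed row `r`), sums to `J`
    (∀ r c : Fin (d + 2),
      ∑ j : Fin (d + 1), ForestId.rhs r c j = ForestId.sumNonForbidden (d + 2)) ∧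
    -- the non-forbidden monomials are the permissible ones, whatever `c` is
    (∀ (c : Fin (d + 2)) (A : ForestId.APart (d + 2)) (B : ForestId.BPart (d + 2)),
      ¬ ForestId.Forbidden A.1 B.1 ↔ ∃ j, ForestId.Permissible c j A B) ∧
    -- on every graph with `m = d + 2` marked vertices
    (∀ (V : Type u) [Fintype V] (G : SimpleGraph V) (v : Fin (d + 2) ↪ V),
      -- the members of the blocks arise from the column expansion identities and hold
      (∀ (r c : Fin (d + 2)) (j : Fin (d + 1)),
        ForestId.ArisesFromColumnExpansion G v r c j ∧
        ForestId.forestPoly G v ⊤ * ForestId.forestPoly G v ⊥ =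
          ForestId.evalAB G v (ForestId.rhs r c j)) ∧
      -- the sum of a block has `m - 1` copies of `(1,…,1)(1,…,m)` on the left and `J` on the right
      (d + 1) • (ForestId.forestPoly G v ⊤ * ForestId.forestPoly G v ⊥) =
        ForestId.evalAB G v (ForestId.sumNonForbidden (d + 2))) := by
  refine ⟨ForestId.sum_rhs, ForestId.not_forbidden_iff_permissible, fun V _ G v =>
    ⟨fun r c j => ⟨ForestId.arisesFromColumnExpansion G v r c j,
      ForestId.forestPoly_top_mul_forestPoly_bot G v r c j⟩, ?_⟩⟩
  -- All blocks have the same sum, so the choice `r = c = 0` is immaterial.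
  rw [← ForestId.sum_rhs 0 0, map_sum, Finset.sum_congr rfl fun j _ =>
    (ForestId.forestPoly_top_mul_forestPoly_bot G v 0 0 j).symm]
  simp
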